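/- Let $-\infty\le a<b\le+\infty$, $I=(a,b)\subseteq\mathbb R$, let $\mu,\nu$ be non-negative Borel measures on $I$, and let $0<p,q\le+\infty$. Let $B^+(I)$ be the set of non-negative (values $+\infty$ allowed) Borel measurable functions on $I$. For $f\in B^+(I)$ and Borel $E\subseteq I$ put $\|f\|_{p,E,\mu}=\left(\int_E f^p\,d\mu\right)^{1/p}$ if $p<\infty$, and let $\|f\|_{\infty,E,\mu}$ be the $\mu$-essential supremum of $f$ over $E$. The conventions $1/\infty=0$, $1/0=\infty$, $0\cdot\infty=0$, $0/0=0$ are used. Let $w,u\in B^+(I)$ with $\|u\|_{q,[t,b),\nu}<\infty$ for all $t\in I$, and consider the inequality $$\|gw\|_{p,(a,b),\mu}\le c\,\bigl\|u(x)\,\|g\|_{\infty,(a,x),\mu}\bigr\|_{q,(a,b),\nu}\qquad\text{for all } g\in B^+(I).\tag{$*$}$$ We say that $(*)$ holds if it holds with some constant $0<c<\infty$; its best constant is the infimum of all admissible $c\in[0,\infty)$ ($\infty$ if there are none). We write $A\approx B$ if $K^{-1}B\le A\le KB$ with a constant $K\in(0,\infty)$ depending only on $p$ and $q$ (not on $a,b,\mu,\nu,u,w$).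 For a non-decreasing, left-continuous $h:I\to[0,\infty]$ and $f:I\to[0,\infty]$, the Lebesgue–Stieltjes integral $\int_{(a,b)}f\,dh$ is understood as follows. Let $c_0\in[a,b]$ be such that $h<\infty$ on $(a,c_0)$ and $h=\infty$ on $(c_0,b)$. If $f$ vanishes on $[c_0,b)\cap I$, the integral is $\int_{(a,c_0)}f\,d\lambda$, where $\lambda$ is the Borel measure on $(a,c_0)$ with $\lambda([\alpha,\beta))=h(\beta)-h(\alpha)$; otherwise it is $+\infty$. (If $h<\infty$ on $I$, this is the usual integral over $I$.) **Theorem.** (i) Let $0<q\le p\le+\infty$. Then $(*)$ holds if and only if $$B_1:=\Bigl\|\,\|w\|_{p,[x,b),\mu}\,\|u\|_{q,(x,b),\nu}^{-1}\Bigr\|_{\infty,(a,b),\mu}<\infty,$$ and the best constant $c$ in $(*)$ satisfies $c\approx B_1$. (ii) Let $0<p<q<+\infty$ and $1/r=1/p-1/q$. Then $(*)$ holds if and only if $$B_2:=\left(\int_{(a,b)}\|w\|_{p,[x,b),\mu}^{r}\,d\bigl(\|u\|_{q,[x,b),\nu}^{-r}\bigr)\right)^{1/r}+\|w\|_{p,(a,b),\mu}\,\|u\|_{q,(a,b),\nu}^{-1}<\infty,$$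 and the best constant $c$ in $(*)$ satisfies $c\approx B_2$. (iii) Let $0<p<+\infty$, $q=+\infty$. Then $(*)$ holds if and only if $$B_3:=\left(\int_{(a,b)}\left(\frac{w(x)}{\|u\|_{\infty,(x,b),\nu}}\right)^{p}d\mu(x)\right)^{1/p}<\infty,$$ and the best constant $c$ in $(*)$ satisfies $c\approx B_3$. Moreover $$B_3\approx\left(\int_{(a,b)}\|w\|_{p,[x,b),\mu}^{p}\,d\bigl(\|u\|_{\infty,[x-,b),\nu}^{-p}\bigr)\right)^{1/p}+\|w\|_{p,(a,b),\mu}\,\|u\|_{\infty,(a,b),\nu}^{-1},$$ where $\|u\|_{\infty,[x-,b),\nu}:=\lim_{s\to x-}\|u\|_{\infty,[s,b),\nu}$. -/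

import Mathlib

open MeasureTheory Set
open scoped ENNReal NNReal

noncomputable section

namespace ReverseHardy

/-- The open interval `(a, b) ⊆ ℝ`, with possibly infinite endpoints. -/
def interval (a b : EReal) : Set ℝ := {x : ℝ | a < (x : EReal) ∧ (x : EReal) < b}

/-- `‖f‖_{p,E,μ}` for a `[0,∞]`-valued function `f` on `E`: the quantity
`(∫_E f ^ p dμ) ^ (1/p)` for `0 < p < ∞`, and the `μ`-essential supremum of `f` over `E`
for `p = ∞`. -/
def lpNorm (p : ℝ≥0∞) (E : Set ℝ) (μ : Measure ℝ) (f : ℝ → ℝ≥0∞) : ℝ≥0∞ :=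
  eLpNorm f p (μ.restrict E)

/-- The inequality `‖g w‖_{p,I,μ} ≤ c ‖u(x) ‖g‖_{∞,(a,x),μ}‖_{q,I,ν}` for all
non-negative Borel functions `g`, where `I = (a,b)`; here `(a,x) = I ∩ (-∞,x)`. -/
def InequalityHolds (p q : ℝ≥0∞) (I : Set ℝ) (μ ν : Measure ℝ) (u w : ℝ → ℝ≥0∞)
    (c : ℝ≥0) : Prop :=
  ∀ g : ℝ → ℝ≥0∞, Measurable g →
    lpNorm p I μ (fun x => g x * w x) ≤
      (c : ℝ≥0∞) * lpNorm q I ν (fun x => u x * lpNorm ∞ (I ∩ Iio x) μ g)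

/-- The best constant: the infimum of all finite admissible `c` (`∞` if there is none). -/
def bestConstant (p q : ℝ≥0∞) (I : Set ℝ) (μ ν : Measure ℝ) (u w : ℝ → ℝ≥0∞) : ℝ≥0∞ :=
  ⨅ (c : ℝ≥0) (_ : InequalityHolds p q I μ ν u w c), (c : ℝ≥0∞)

/-! ### Lebesgue–Stieltjes integrals against non-decreasing `[0,∞]`-valued functions -/

/-- The real-valued function equal to `h` on `[α, β]` and constant on either side. -/
def clamp (h : ℝ → ℝ≥0∞) (α β x : ℝ) : ℝ := (h (max α (min x β))).toReal

theorem clamp_monotone {h : ℝ → ℝ≥0∞} (hh : Monotone h) {α β : ℝ} (hαβ : α ≤ β)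
    (hβ : h β ≠ ∞) : Monotone (clamp h α β) := by
  intro x y hxy
  refine ENNReal.toReal_mono (ne_top_of_le_ne_top hβ (hh ?_)) (hh ?_)
  · exact max_le hαβ (min_le_right _ _)
  · exact max_le_max le_rfl (min_le_min hxy le_rfl)

open Classical in
/-- The Lebesgue–Stieltjes integral `∫_I f dh` over an open interval `I = (a,b)`, for
`f : I → [0,∞]` and a non-decreasing `h : I → [0,∞]`.

Let `c ∈ [a,b]` be the point such that `h < ∞` on `(a,c)` and `h = ∞` on `(c,b)`.
If `f` does not vanish on `[c,b)` (that is, at some `x ∈ I` with `h = ∞` on `(x,b)`), the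
integral has the value `∞`. Otherwise it is the integral of `f` over `(a,c)` with respect to the
Lebesgue–Stieltjes measure of the finite function `h` on `(a,c)`, i.e. the supremum over
`α ≤ β` in `I` with `h β < ∞` of the integrals over `(α,β)`. If `h < ∞` on `I`, then
`(a,c) = I` and there is no condition on `f`. -/
def stieltjesIntegral (I : Set ℝ) (f h : ℝ → ℝ≥0∞) (hh : Monotone h) : ℝ≥0∞ :=
  if ∀ x ∈ I, (∀ y ∈ I, x < y → h y = ∞) → f x = 0 then
    ⨆ (α : ℝ) (β : ℝ) (_ : α ∈ I) (_ : β ∈ I) (hαβ : α ≤ β) (hβ : h β ≠ ∞),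
      ∫⁻ x in Ioo α β, f x ∂(clamp_monotone hh hαβ hβ).stieltjesFunction.measure
  else ∞

/-! ### The weight functions `x ↦ ‖u‖_{q,[x,b),ν}` and their negative powers -/

/-- `x ↦ ‖f‖_{p,[x,b),μ}` for `I = (a,b)`. -/
def tailNorm (p : ℝ≥0∞) (I : Set ℝ) (μ : Measure ℝ) (f : ℝ → ℝ≥0∞) (x : ℝ) : ℝ≥0∞ :=
  lpNorm p (I ∩ Ici x) μ f

/-- `x ↦ ‖f‖_{p,(x,b),μ}` for `I = (a,b)`. -/
def openTailNorm (p : ℝ≥0∞) (I : Set ℝ) (μ : Measure ℝ) (f : ℝ → ℝ≥0∞) (x : ℝ) : ℝ≥0∞ :=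
  lpNorm p (I ∩ Ioi x) μ f

theorem tailNorm_antitone (p : ℝ≥0∞) (I : Set ℝ) (μ : Measure ℝ) (f : ℝ → ℝ≥0∞) :
    Antitone (tailNorm p I μ f) := fun _ _ hxy =>
  eLpNorm_mono_measure _
    (Measure.restrict_mono (inter_subset_inter_right I (Ici_subset_Ici.2 hxy)) le_rfl)

theorem rpow_neg_monotone {U : ℝ → ℝ≥0∞} (hU : Antitone U) {r : ℝ} (hr : 0 ≤ r) :
    Monotone fun x => U x ^ (-r) := fun x y hxy => by
  simp only [ENNReal.rpow_neg]
  exact ENNReal.inv_le_inv.2 (ENNReal.rpow_le_rpow (hU hxy) hr)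

theorem leftLim_tailNorm_antitone (p : ℝ≥0∞) (I : Set ℝ) (μ : Measure ℝ) (f : ℝ → ℝ≥0∞) :
    Antitone (Function.leftLim (tailNorm p I μ f)) :=
  (tailNorm_antitone p I μ f).leftLim

/-! ### The characterizing quantities -/

/-- `‖ ‖w‖_{p,[x,b),μ} ‖u‖_{q,(x,b),ν}⁻¹ ‖_{∞,(a,b),μ}`. -/
def B₁ (p q : ℝ≥0∞) (I : Set ℝ) (μ ν : Measure ℝ) (u w : ℝ → ℝ≥0∞) : ℝ≥0∞ :=
  lpNorm ∞ I μ fun x => tailNorm p I μ w x * (openTailNorm q I ν u x)⁻¹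

/-- `(∫_{(a,b)} ‖w‖_{p,[x,b),μ}^r d(‖u‖_{q,[x,b),ν}^{-r}))^{1/r}
  + ‖w‖_{p,(a,b),μ} ‖u‖_{q,(a,b),ν}⁻¹`. -/
def B₂ (p q : ℝ≥0∞) (r : ℝ) (hr : 0 ≤ r) (I : Set ℝ) (μ ν : Measure ℝ)
    (u w : ℝ → ℝ≥0∞) : ℝ≥0∞ :=
  stieltjesIntegral I (fun x => tailNorm p I μ w x ^ r) (fun x => tailNorm q I ν u x ^ (-r))
      (rpow_neg_monotone (tailNorm_antitone q I ν u) hr) ^ (1 / r)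
    + lpNorm p I μ w * (lpNorm q I ν u)⁻¹

/-- `(∫_{(a,b)} (w(x) / ‖u‖_{∞,(x,b),ν})^p dμ(x))^{1/p}`. -/
def B₃ (p : ℝ≥0∞) (I : Set ℝ) (μ ν : Measure ℝ) (u w : ℝ → ℝ≥0∞) : ℝ≥0∞ :=
  (∫⁻ x in I, (w x / openTailNorm ∞ I ν u x) ^ p.toReal ∂μ) ^ (1 / p.toReal)

/-- `(∫_{(a,b)} ‖w‖_{p,[x,b),μ}^p d(‖u‖_{∞,[x-,b),ν}^{-p}))^{1/p}
  + ‖w‖_{p,(a,b),μ} ‖u‖_{∞,(a,b),ν}⁻¹`,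
where `‖u‖_{∞,[x-,b),ν}` is the left limit of `s ↦ ‖u‖_{∞,[s,b),ν}` at `x`. -/
def B₃Stieltjes (p : ℝ≥0∞) (I : Set ℝ) (μ ν : Measure ℝ) (u w : ℝ → ℝ≥0∞) : ℝ≥0∞ :=
  stieltjesIntegral I (fun x => tailNorm p I μ w x ^ p.toReal)
      (fun x => Function.leftLim (tailNorm ∞ I ν u) x ^ (-p.toReal))
      (rpow_neg_monotone (leftLim_tailNorm_antitone ∞ I ν u) ENNReal.toReal_nonneg)
        ^ (1 / p.toReal)
    + lpNorm p I μ w * (lpNorm ∞ I ν u)⁻¹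

end ReverseHardy

end

/-!
The inequality says that `‖g w‖_{p,μ}` is controlled by the running essential suprema
`G x = ‖g‖_{∞,(a,x),μ}`. Write `Gp x = ‖g‖_{∞,(a,x],μ}`, so that `g ≤ Gp` almost everywhere and
`Gp x ≤ G y` for `x < y`; besides monotonicity these two facts are all that the upper estimates use
about `G` and `Gp`. No σ-finiteness is assumed, so Fubini's theorem is not available for `μ` and `ν`;
everything is reduced to dyadic sums (`tsum_dyad_le`, `rpow_le_layerSum`,
`lintegral_rpow_le_tsum_dyad`) and to the fact that a set of reals is exhausted by countably many of
its upper, or lower, parts (`measure_le_of_forall_inter_Ici_le`).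

*Case `q ≤ p`.* Testing with the indicators of `[t, b)` gives `‖w‖_{p,[t,b)} ≤ c ‖u‖_{q,(t,b)}`, and
the almost everywhere bound expressed by `B₁` implies the same bound at every point. Conversely this
bound compares the level sets `{Gp > 2 ^ k}` and `{G > 2 ^ k}`, and `ℓ^q ⊆ ℓ^p` sums over `k`.

*Case `p < q < ∞`.* Put `v x = ‖u‖_{q,(x,b)}⁻¹` and `T_j = {v ≥ 2 ^ j}`. The best constant and `B₂`
are both compared with `dyadicSum`, i.e. with `X = ∑_j (2 ^ j ‖w‖_{p,T_j}) ^ r`.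
The function `v ^ r` is the right regularization of `‖u‖_{q,[x,b)} ^ (-r)`, so it determines the
Stieltjes measure; this measure gives the layer `T_j \ T_{j+1}` at most the mass `2 ^ ((j + 1) r)`,
and together with the mass of the left endpoint it gives `(a, x]`, for every `x ∈ T_j`, at least the
mass `2 ^ (j r)` (`stieltjes_add_le_dyadicSum`, `dyadicSum_le_stieltjes_add`).
For sufficiency, `∫ Gp ^ p w ^ p dμ` is split along the layers of `v`, with Hölder's inequality in
`j` (`lpNorm_le_dyadicSum`). For necessity the test function is `g = ⨆_j c_j 1_{T_j}` with
`c_j = 2 ^ (j r / p) ‖w‖_{p,T_j} ^ (r / q)`: the right-hand side is at most `X ^ (1 / q)`, and the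
`p`-th power of the left-hand side is at least `(1 - 2 ^ (-p)) X`, since Hölder's inequality bounds
the part of the sum lost in passing from `T_j` to `T_j \ T_{j+1}` by `2 ^ (-p) X`
(`tsum_windowLevel_le`).

*Case `q = ∞`.* The function `g = ‖u‖_{∞,(x,b)}⁻¹` is extremal, and `B₃` is exactly the best
constant. The Stieltjes form of `B₃` follows since `B₃ ^ p` is comparable with the dyadic sum `X`
for `r = p`.
-/

namespace ReverseHardy

/-! ### Dyadic sums -/

/-- The dyadic number `2 ^ j`, `j ∈ ℤ`, written with a real exponent so that the `rpow` lemmas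
apply to its powers. -/
noncomputable def dyad (j : ℤ) : ℝ≥0∞ := 2 ^ (j : ℝ)

theorem dyad_eq_zpow (j : ℤ) : dyad j = 2 ^ j := by
  rw [dyad, ENNReal.rpow_intCast]

theorem dyad_ne_zero (j : ℤ) : dyad j ≠ 0 := by
  rw [dyad, Ne, ENNReal.rpow_eq_zero_iff]
  simp

theorem dyad_ne_top (j : ℤ) : dyad j ≠ ∞ := by
  rw [dyad, Ne, ENNReal.rpow_eq_top_iff]
  simp

theorem dyad_rpow (j : ℤ) (s : ℝ) : dyad j ^ s = 2 ^ ((j : ℝ) * s) := by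
  rw [dyad, ENNReal.rpow_mul]

theorem dyad_rpow_ne_zero (j : ℤ) (s : ℝ) : dyad j ^ s ≠ 0 := by
  simp [dyad_rpow, ENNReal.rpow_eq_zero_iff]

theorem dyad_rpow_ne_top (j : ℤ) (s : ℝ) : dyad j ^ s ≠ ∞ := by
  simp [dyad_rpow, ENNReal.rpow_eq_top_iff]

theorem dyad_neg (j : ℤ) : dyad (-j) = (dyad j)⁻¹ := by
  simp [dyad, ENNReal.rpow_neg]

theorem dyad_succ (j : ℤ) : dyad (j + 1) = 2 * dyad j := by
  rw [dyad, dyad, Int.cast_add, ENNReal.rpow_add _ _ two_ne_zero ENNReal.ofNat_ne_top]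
  simp [mul_comm]

theorem dyad_mono {i j : ℤ} (h : i ≤ j) : dyad i ≤ dyad j :=
  ENNReal.rpow_le_rpow_of_exponent_le one_le_two (by exact_mod_cast h)

theorem dyad_lt_iff {i j : ℤ} : dyad i < dyad j ↔ i < j := by
  refine ⟨fun h => by_contra fun h' => absurd (dyad_mono (not_lt.1 h')) (not_le.2 h), fun h => ?_⟩
  exact ENNReal.rpow_lt_rpow_of_exponent_lt ENNReal.one_lt_two ENNReal.ofNat_ne_top (by exact_mod_cast h)

/-- The constant in the comparison `tsum_dyad_le` of a sum of powers `2 ^ (j s)` with its largest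
term. -/
noncomputable def geomConst (s : ℝ) : ℝ≥0∞ := 2 ^ s * (1 - 2 ^ (-s))⁻¹

theorem two_rpow_neg_lt_one {s : ℝ} (hs : 0 < s) : (2 : ℝ≥0∞) ^ (-s) < 1 :=
  ENNReal.rpow_lt_one_of_one_lt_of_neg ENNReal.one_lt_two (by linarith)

theorem two_rpow_ne_zero (s : ℝ) : (2 : ℝ≥0∞) ^ s ≠ 0 := by
  simp [ENNReal.rpow_eq_zero_iff]

theorem two_rpow_ne_top (s : ℝ) : (2 : ℝ≥0∞) ^ s ≠ ∞ := by
  simp [ENNReal.rpow_eq_top_iff]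

theorem geomConst_ne_top {s : ℝ} (hs : 0 < s) : geomConst s ≠ ∞ := by
  refine ENNReal.mul_ne_top (two_rpow_ne_top s) (ENNReal.inv_ne_top.2 ?_)
  exact (tsub_pos_of_lt (two_rpow_neg_lt_one hs)).ne'

theorem geomConst_ne_zero (s : ℝ) : geomConst s ≠ 0 := by
  refine mul_ne_zero (two_rpow_ne_zero s) (ENNReal.inv_ne_zero.2 ?_)
  exact ne_top_of_le_ne_top ENNReal.one_ne_top tsub_le_self

theorem exists_mem_Ioc_dyad {y : ℝ≥0∞} (h0 : y ≠ 0) (ht : y ≠ ∞) :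
    ∃ n : ℤ, dyad n < y ∧ y ≤ dyad (n + 1) := by
  obtain ⟨n, hn⟩ := ENNReal.exists_mem_Ioc_zpow h0 ht ENNReal.one_lt_two ENNReal.ofNat_ne_top
  exact ⟨n, by rw [dyad_eq_zpow, dyad_eq_zpow]; exact hn⟩

theorem exists_mem_Ico_dyad {y : ℝ≥0∞} (h0 : y ≠ 0) (ht : y ≠ ∞) :
    ∃ n : ℤ, dyad n ≤ y ∧ y < dyad (n + 1) := by
  obtain ⟨n, hn⟩ := ENNReal.exists_mem_Ico_zpow h0 ht ENNReal.one_lt_two ENNReal.ofNat_ne_top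
  exact ⟨n, by rw [dyad_eq_zpow, dyad_eq_zpow]; exact hn⟩

/-- A sum of distinct dyadic powers is comparable to its largest term. -/
theorem tsum_dyad_le {s : ℝ} (hs : 0 < s) {P : Set ℤ} {M : ℝ≥0∞}
    (h : ∀ j ∈ P, dyad j ^ s ≤ M) :
    ∑' j, P.indicator (fun j => dyad j ^ s) j ≤ geomConst s * M := by
  rcases eq_or_ne M 0 with rfl | hM0
  · have : ∀ j, j ∉ P := fun j hj => dyad_rpow_ne_zero j s (le_antisymm (h j hj) zero_le)
    simp [this]
  rcases eq_or_ne M ∞ with rfl | hMt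
  · rw [ENNReal.mul_top (geomConst_ne_zero s)]; exact le_top
  have hM : (M ^ s⁻¹) ^ s = M := ENNReal.rpow_inv_rpow hs.ne' M
  obtain ⟨n, hn1, hn2⟩ := exists_mem_Ioc_dyad (y := M ^ s⁻¹)
    (by simp [ENNReal.rpow_eq_zero_iff, hM0, hMt]) (by simp [ENNReal.rpow_eq_top_iff, hM0, hMt])
  have hP : ∀ j ∈ P, j ≤ n + 1 := fun j hj => by
    by_contra hj'
    have h1 : dyad j ≤ M ^ s⁻¹ := by
      have := h j hj
      rwa [← hM, ENNReal.rpow_le_rpow_iff hs] at this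
    exact absurd (dyad_lt_iff.2 (not_le.1 hj')) (not_lt.2 (h1.trans hn2))
  have hinj : Function.Injective fun i : ℕ => n + 1 - (i : ℤ) := fun i j hij => by
    simpa using hij
  have hsupp : Function.support (P.indicator fun j => dyad j ^ s) ⊆
      range fun i : ℕ => n + 1 - (i : ℤ) := by
    intro j hj
    have hj : j ∈ P := by
      by_contra h'
      simp [h'] at hj
    exact ⟨(n + 1 - j).toNat, by have := hP j hj; simp; omega⟩
  rw [← hinj.tsum_eq hsupp]
  calc ∑' i : ℕ, P.indicator (fun j => dyad j ^ s) (n + 1 - (i : ℤ))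
      ≤ ∑' i : ℕ, dyad (n + 1) ^ s * ((2 : ℝ≥0∞) ^ (-s)) ^ i := by
        refine ENNReal.tsum_le_tsum fun i => ?_
        refine indicator_apply_le' (fun _ => ?_) (fun _ => zero_le)
        rw [dyad_rpow, dyad_rpow, ← ENNReal.rpow_natCast, ← ENNReal.rpow_mul,
            ← ENNReal.rpow_add _ _ two_ne_zero ENNReal.ofNat_ne_top]
        refine le_of_eq ?_
        congr 1
        push_cast
        ring
    _ = dyad (n + 1) ^ s * (1 - 2 ^ (-s))⁻¹ := by
        rw [ENNReal.tsum_mul_left, ENNReal.tsum_geometric]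
    _ ≤ (2 ^ s * M) * (1 - 2 ^ (-s))⁻¹ := by
        gcongr
        rw [dyad_succ, ENNReal.mul_rpow_of_nonneg _ _ hs.le]
        gcongr
        rw [← hM]
        exact ENNReal.rpow_le_rpow hn1.le hs.le
    _ = geomConst s * M := by rw [geomConst]; ring

theorem tsum_dyad_inv_le {s : ℝ} (hs : 0 < s) {P : Set ℤ} {M : ℝ≥0∞}
    (h : ∀ j ∈ P, (dyad j)⁻¹ ^ s ≤ M) :
    ∑' j, P.indicator (fun j => (dyad j)⁻¹ ^ s) j ≤ geomConst s * M := by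
  rw [← (Equiv.neg ℤ).tsum_eq]
  have := tsum_dyad_le hs (P := -P) (M := M) fun j hj => by simpa [← dyad_neg] using h _ hj
  refine le_trans (le_of_eq (tsum_congr fun j => ?_)) this
  by_cases hj : -j ∈ P <;> simp [indicator, ← dyad_neg, Set.mem_neg, hj]

/-- The dyadic layer-cake sum `∑_{2 ^ k < y} 2 ^ (k s)`, which is comparable to `y ^ s`. -/
noncomputable def layerSum (s : ℝ) (y : ℝ≥0∞) : ℝ≥0∞ :=
  ∑' k : ℤ, {k | dyad k < y}.indicator (fun k => dyad k ^ s) k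

theorem layerSum_le {s : ℝ} (hs : 0 < s) (y : ℝ≥0∞) : layerSum s y ≤ geomConst s * y ^ s :=
  tsum_dyad_le hs fun _ hj => ENNReal.rpow_le_rpow (le_of_lt hj) hs.le

theorem tsum_dyad_rpow {s : ℝ} (hs : 0 < s) : ∑' k : ℤ, dyad k ^ s = ∞ := by
  refine top_unique ?_
  calc (∞ : ℝ≥0∞) = ∑' _ : ℕ, (1 : ℝ≥0∞) := by simp
    _ ≤ ∑' i : ℕ, dyad (i : ℤ) ^ s := ENNReal.tsum_le_tsum fun i => by
        refine ENNReal.one_le_rpow ?_ hs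
        rw [dyad_eq_zpow, zpow_natCast]
        exact one_le_pow₀ one_le_two
    _ ≤ ∑' k : ℤ, dyad k ^ s :=
        ENNReal.tsum_comp_le_tsum_of_injective Nat.cast_injective _

theorem rpow_le_layerSum {s : ℝ} (hs : 0 < s) (y : ℝ≥0∞) : y ^ s ≤ 2 ^ s * layerSum s y := by
  rcases eq_or_ne y 0 with rfl | h0
  · simp [ENNReal.zero_rpow_of_pos hs]
  rcases eq_or_ne y ∞ with rfl | ht
  · have : layerSum s ∞ = ∞ := by
      simp only [layerSum, (dyad_ne_top _).lt_top, ofPred_true, indicator_univ]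
      exact tsum_dyad_rpow hs
    rw [this, ENNReal.mul_top (two_rpow_ne_zero s)]
    exact le_top
  obtain ⟨n, hn1, hn2⟩ := exists_mem_Ioc_dyad h0 ht
  calc y ^ s ≤ dyad (n + 1) ^ s := ENNReal.rpow_le_rpow hn2 hs.le
    _ = 2 ^ s * dyad n ^ s := by rw [dyad_succ, ENNReal.mul_rpow_of_nonneg _ _ hs.le]
    _ ≤ 2 ^ s * layerSum s y := by
        gcongr
        refine le_trans ?_ (ENNReal.le_tsum n)
        simp [hn1]

theorem lintegral_layerSum (m : Measure ℝ) (E : Set ℝ)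
    {f : ℝ → ℝ≥0∞} (hf : Measurable f) (s : ℝ) :
    ∫⁻ x in E, layerSum s (f x) ∂m = ∑' k, dyad k ^ s * m (E ∩ {x | dyad k < f x}) := by
  have hm : ∀ k, MeasurableSet {x | dyad k < f x} := fun k =>
    measurableSet_lt measurable_const hf
  have heq : ∀ x, layerSum s (f x) = ∑' k, {x | dyad k < f x}.indicator (fun _ => dyad k ^ s) x :=
    fun x => rfl
  simp only [heq]
  rw [lintegral_tsum fun k => (measurable_const.indicator (hm k)).aemeasurable]
  refine tsum_congr fun k => ?_
  rw [lintegral_indicator_const (hm k), Measure.restrict_apply (hm k), inter_comm]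

theorem tsum_dyad_mul_measure_le (m : Measure ℝ) (E : Set ℝ)
    {f : ℝ → ℝ≥0∞} (hf : Measurable f) {s : ℝ} (hs : 0 < s) :
    ∑' k, dyad k ^ s * m (E ∩ {x | dyad k < f x}) ≤ geomConst s * ∫⁻ x in E, f x ^ s ∂m := by
  rw [← lintegral_layerSum m E hf, ← lintegral_const_mul _ (hf.pow_const s)]
  exact lintegral_mono fun x => layerSum_le hs _

theorem lintegral_rpow_le_tsum_dyad (m : Measure ℝ) (E : Set ℝ)
    {f : ℝ → ℝ≥0∞} (hf : Measurable f) {s : ℝ} (hs : 0 < s) :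
    ∫⁻ x in E, f x ^ s ∂m ≤ 2 ^ s * ∑' k, dyad k ^ s * m (E ∩ {x | dyad k < f x}) := by
  rw [← lintegral_layerSum m E hf, ← lintegral_const_mul' _ _ (two_rpow_ne_top s)]
  exact lintegral_mono fun x => rpow_le_layerSum hs _

/-! ### Inequalities for sums of powers -/

/-- Hölder's inequality for sums, in the form of weighted exponents. -/
theorem tsum_rpow_mul_rpow_le (f g : ℤ → ℝ≥0∞) {s t : ℝ} (hs : 0 ≤ s) (ht : 0 ≤ t)
    (hst : s + t = 1) :
    ∑' j, f j ^ s * g j ^ t ≤ (∑' j, f j) ^ s * (∑' j, g j) ^ t := by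
  have := ENNReal.lintegral_mul_norm_pow_le (μ := (Measure.count : Measure ℤ)) (f := f) (g := g)
    measurable_from_top.aemeasurable measurable_from_top.aemeasurable hs ht hst
  simpa only [lintegral_count] using this

theorem tsum_rpow_le_rpow_tsum (f : ℤ → ℝ≥0∞) {s : ℝ} (hs : 1 ≤ s) :
    ∑' j, f j ^ s ≤ (∑' j, f j) ^ s := by
  have key : ∀ x : ℝ≥0∞, x ^ s = x * x ^ (s - 1) := fun x => by
    conv_lhs => rw [show s = 1 + (s - 1) by ring,
      ENNReal.rpow_add_of_nonneg _ _ zero_le_one (by linarith), ENNReal.rpow_one]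
  rw [key (∑' j, f j), ← ENNReal.tsum_mul_right]
  refine ENNReal.tsum_le_tsum fun j => ?_
  rw [key]
  exact mul_le_mul' le_rfl (ENNReal.rpow_le_rpow (ENNReal.le_tsum j) (by linarith))

/-! ### Exhausting a set of reals from one side -/

/-- The measure of a set is controlled by the measures of its upper parts; neither measurability
of `A` nor any finiteness of `m` is needed. -/
theorem measure_le_of_forall_inter_Ici_le (m : Measure ℝ) {A : Set ℝ} {c : ℝ≥0∞}
    (h : ∀ x ∈ A, m (A ∩ Ici x) ≤ c) : m A ≤ c := by
  rcases A.eq_empty_or_nonempty with rfl | hA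
  · simp
  -- The infimum is taken in `EReal`, so that sets unbounded below need no separate treatment.
  set B : Set EReal := (fun x : ℝ => (x : EReal)) '' A
  obtain ⟨t, ht, ht1, ht2, ht3⟩ :=
    (isGLB_sInf B).exists_seq_antitone_tendsto (hA.image _)
  choose y hyA hy using ht3
  have hmono : Monotone fun n => A ∩ Ici (y n) := fun i j hij x hx => by
    refine ⟨hx.1, le_trans (b := y i) ?_ hx.2⟩
    have := ht hij
    simp only at hy
    rw [← hy, ← hy] at this
    exact_mod_cast this
  by_cases hmin : ∃ x ∈ A, ∀ z ∈ A, x ≤ z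
  · obtain ⟨x, hx, hx'⟩ := hmin
    have hsub : A ⊆ A ∩ Ici x := fun z hz => ⟨hz, hx' z hz⟩
    exact (measure_mono hsub).trans (h x hx)
  push Not at hmin
  have hU : A ⊆ ⋃ n, A ∩ Ici (y n) := fun x hx => by
    obtain ⟨z, hz, hzx⟩ := hmin x hx
    have h1 : sInf B < (x : EReal) :=
      lt_of_le_of_lt (sInf_le (mem_image_of_mem _ hz)) (by exact_mod_cast hzx)
    obtain ⟨n, hn⟩ := (ht2.eventually (gt_mem_nhds h1)).exists
    simp only at hy
    rw [← hy] at hn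
    have h2 : y n ≤ x := le_of_lt (by exact_mod_cast hn)
    exact mem_iUnion_of_mem n ⟨hx, h2⟩
  refine (measure_mono hU).trans ?_
  rw [hmono.measure_iUnion]
  exact iSup_le fun n => h _ (hyA n)

theorem measure_le_of_forall_inter_Iic_le (m : Measure ℝ) {A : Set ℝ} {c : ℝ≥0∞}
    (h : ∀ x ∈ A, m (A ∩ Iic x) ≤ c) : m A ≤ c := by
  have := measure_le_of_forall_inter_Ici_le (m.map (MeasurableEquiv.neg ℝ)) (A := -A) (c := c)
    fun x hx => by
      rw [MeasurableEquiv.map_apply]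
      refine le_trans (measure_mono fun z hz => ?_) (h (-x) hx)
      simpa [le_neg] using hz
  rw [MeasurableEquiv.map_apply] at this
  simpa using this

/-! ### The norms `lpNorm` -/

section LpNorm

variable {p : ℝ≥0∞} {E F : Set ℝ} {μ : Measure ℝ} {f g : ℝ → ℝ≥0∞}

theorem lpNorm_rpow (hp : p ≠ 0) (hp' : p ≠ ∞) :
    lpNorm p E μ f ^ p.toReal = ∫⁻ x in E, f x ^ p.toReal ∂μ := by
  rw [lpNorm, eLpNorm_eq_lintegral_rpow_enorm_toReal hp hp', ← ENNReal.rpow_mul,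
    one_div_mul_cancel (ENNReal.toReal_pos hp hp').ne', ENNReal.rpow_one]
  simp only [enorm_eq_self]

theorem lpNorm_top_le_iff {c : ℝ≥0∞} :
    lpNorm ∞ E μ f ≤ c ↔ ∀ᵐ x ∂μ.restrict E, f x ≤ c := by
  rw [lpNorm, eLpNorm_exponent_top, eLpNormEssSup]
  simp only [enorm_eq_self]
  refine ⟨fun h => ?_, fun h => essSup_le_of_ae_le c h⟩
  filter_upwards [ENNReal.ae_le_essSup (μ := μ.restrict E) f] with x hx using hx.trans h

theorem ae_le_lpNorm_top : ∀ᵐ x ∂μ.restrict E, f x ≤ lpNorm ∞ E μ f :=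
  lpNorm_top_le_iff.1 le_rfl

theorem lpNorm_mono_set (h : E ⊆ F) : lpNorm p E μ f ≤ lpNorm p F μ f :=
  eLpNorm_mono_measure _ (Measure.restrict_mono h le_rfl)

theorem lpNorm_mono_ae (h : ∀ᵐ x ∂μ.restrict E, f x ≤ g x) :
    lpNorm p E μ f ≤ lpNorm p E μ g :=
  eLpNorm_mono_enorm_ae (by simpa only [enorm_eq_self] using h)

theorem lpNorm_mono (hE : MeasurableSet E) (h : ∀ x ∈ E, f x ≤ g x) :
    lpNorm p E μ f ≤ lpNorm p E μ g :=
  lpNorm_mono_ae (ae_restrict_of_forall_mem hE h)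

theorem lpNorm_const_mul (hp : p ≠ 0) (hf : Measurable f) (c : ℝ≥0∞) :
    lpNorm p E μ (fun x => c * f x) = c * lpNorm p E μ f := by
  rcases eq_or_ne p ∞ with rfl | hp'
  · simp only [lpNorm, eLpNorm_exponent_top, eLpNormEssSup, enorm_eq_self]
    exact ENNReal.essSup_const_mul
  · have hP := ENNReal.toReal_pos hp hp'
    have h : (lpNorm p E μ fun x => c * f x) ^ p.toReal = (c * lpNorm p E μ f) ^ p.toReal := by
      rw [ENNReal.mul_rpow_of_nonneg _ _ hP.le, lpNorm_rpow hp hp', lpNorm_rpow hp hp',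
        ← lintegral_const_mul _ (hf.pow_const _)]
      simp only [ENNReal.mul_rpow_of_nonneg _ _ hP.le]
    exact ENNReal.rpow_left_injective hP.ne' h

theorem lpNorm_indicator {s : Set ℝ} (hs : MeasurableSet s) :
    lpNorm p E μ (s.indicator f) = lpNorm p (E ∩ s) μ f := by
  rw [lpNorm, eLpNorm_indicator_eq_eLpNorm_restrict hs, Measure.restrict_restrict hs, inter_comm]
  rfl

theorem withDensity_eq_lpNorm (hp : p ≠ 0) (hp' : p ≠ ∞) (hE : MeasurableSet E) :
    (μ.withDensity fun x => f x ^ p.toReal) E = lpNorm p E μ f ^ p.toReal := by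
  rw [withDensity_apply _ hE, lpNorm_rpow hp hp']

theorem lpNorm_mul_rpow (hp : p ≠ 0) (hp' : p ≠ ∞) (hE : MeasurableSet E) (hf : Measurable f)
    (hg : Measurable g) :
    lpNorm p E μ (fun x => g x * f x) ^ p.toReal =
      ∫⁻ x in E, g x ^ p.toReal ∂μ.withDensity fun x => f x ^ p.toReal := by
  rw [lpNorm_rpow hp hp', setLIntegral_withDensity_eq_setLIntegral_mul _ (hf.pow_const _)
    (hg.pow_const _) hE]
  refine lintegral_congr fun x => ?_
  rw [ENNReal.mul_rpow_of_nonneg _ _ ENNReal.toReal_nonneg, Pi.mul_apply, mul_comm]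

/-- The norm over a set is controlled by the norms over its upper parts. -/
theorem lpNorm_le_of_forall_inter_Ici_le (hp : p ≠ 0) (hE : MeasurableSet E) (hf : Measurable f)
    {c : ℝ≥0∞} (h : ∀ x ∈ E, lpNorm p (E ∩ Ici x) μ f ≤ c) : lpNorm p E μ f ≤ c := by
  rcases eq_or_ne p ∞ with rfl | hp'
  · have key : ∀ A : Set ℝ, MeasurableSet A → (lpNorm ∞ A μ f ≤ c ↔
        (μ.restrict {x | c < f x}) A = 0) := fun A hA => by
      rw [lpNorm_top_le_iff, ae_iff, Measure.restrict_apply hA, Measure.restrict_apply]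
      · simp only [not_le, inter_comm]
      · simpa only [not_le] using measurableSet_lt measurable_const hf
    rw [key E hE]
    refine le_antisymm (measure_le_of_forall_inter_Ici_le _ fun x hx => ?_) zero_le
    exact ((key _ (hE.inter measurableSet_Ici)).1 (h x hx)).le
  · have hP := ENNReal.toReal_pos hp hp'
    have key : ∀ A : Set ℝ, MeasurableSet A → (lpNorm p A μ f ≤ c ↔
        (μ.withDensity fun x => f x ^ p.toReal) A ≤ c ^ p.toReal) := fun A hA => by
      rw [withDensity_apply _ hA, ← lpNorm_rpow hp hp', ENNReal.rpow_le_rpow_iff hP]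
    rw [key E hE]
    refine measure_le_of_forall_inter_Ici_le _ fun x hx => ?_
    exact (key _ (hE.inter measurableSet_Ici)).1 (h x hx)

/-- If the sets `J x` exhaust every set of reals in the sense of
`measure_le_of_forall_inter_Ici_le`, then a function is almost everywhere dominated by its
essential suprema over `E ∩ J x`. -/
theorem ae_le_lpNorm_top_inter {J : ℝ → Set ℝ} (hJm : ∀ x, MeasurableSet (J x))
    (hJ : ∀ A : Set ℝ, (∀ x ∈ A, μ (A ∩ J x) ≤ 0) → μ A ≤ 0) (hE : MeasurableSet E) :
    ∀ᵐ x ∂μ.restrict E, f x ≤ lpNorm ∞ (E ∩ J x) μ f := by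
  rw [ae_restrict_iff' hE, ae_iff]
  have hsub : {x | ¬(x ∈ E → f x ≤ lpNorm ∞ (E ∩ J x) μ f)} ⊆
      ⋃ r : ℚ, {x | x ∈ E ∧ lpNorm ∞ (E ∩ J x) μ f < (Real.toNNReal r : ℝ≥0∞) ∧
        (Real.toNNReal r : ℝ≥0∞) < f x} := fun x hx => by
    have hx : ¬(x ∈ E → f x ≤ lpNorm ∞ (E ∩ J x) μ f) := hx
    push Not at hx
    obtain ⟨r, -, h1, h2⟩ := ENNReal.lt_iff_exists_rat_btwn.1 hx.2
    exact mem_iUnion_of_mem r ⟨hx.1, h1, h2⟩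
  refine measure_mono_null hsub (measure_iUnion_null fun r => ?_)
  refine le_antisymm (hJ _ fun x hx => ?_) zero_le
  have h1 : ∀ᵐ y ∂μ.restrict (E ∩ J x), f y ≤ (Real.toNNReal r : ℝ≥0∞) :=
    lpNorm_top_le_iff.1 hx.2.1.le
  rw [ae_restrict_iff' (hE.inter (hJm x)), ae_iff] at h1
  rw [← h1]
  exact measure_mono fun y hy h' => absurd (h' ⟨hy.1.1, hy.2⟩) (not_le.2 hy.1.2.2)

theorem ae_le_lpNorm_top_inter_Iic (hE : MeasurableSet E) :
    ∀ᵐ x ∂μ.restrict E, f x ≤ lpNorm ∞ (E ∩ Iic x) μ f :=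
  ae_le_lpNorm_top_inter (fun _ => measurableSet_Iic)
    (fun _ => measure_le_of_forall_inter_Iic_le μ) hE

theorem ae_le_lpNorm_top_inter_Ici (hE : MeasurableSet E) :
    ∀ᵐ x ∂μ.restrict E, f x ≤ lpNorm ∞ (E ∩ Ici x) μ f :=
  ae_le_lpNorm_top_inter (fun _ => measurableSet_Ici)
    (fun _ => measure_le_of_forall_inter_Ici_le μ) hE

end LpNorm

/-! ### Stieltjes integrals and dyadic sums -/

/-- `k` is the right regularization of the monotone function `h` on `I`, i.e.
`k x = ⨅ y > x, h y` there. The Lebesgue–Stieltjes measure of `h` depends on `k` only. -/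
structure IsRightRegularization (I : Set ℝ) (h k : ℝ → ℝ≥0∞) : Prop where
  le_of_lt : ∀ x ∈ I, ∀ y ∈ I, x < y → k x ≤ h y
  le : ∀ x ∈ I, h x ≤ k x
  exists_lt : ∀ x ∈ I, ∀ c, k x < c → ∃ y ∈ I, x < y ∧ h y < c

theorem rightLim_clamp {I : Set ℝ} (hI : I.OrdConnected) {h k : ℝ → ℝ≥0∞} (hh : Monotone h)
    (hk : IsRightRegularization I h k) {α β : ℝ} (hα : α ∈ I) (hβ : β ∈ I) (hαβ : α ≤ β)
    (hβt : h β ≠ ∞) {x : ℝ} (hx : α ≤ x) (hx' : x < β) :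
    Function.rightLim (clamp h α β) x = (k x).toReal := by
  have hmono := clamp_monotone hh hαβ hβt
  have hxI : x ∈ I := hI.out hα hβ ⟨hx, hx'.le⟩
  have hkt : k x ≠ ∞ := ne_top_of_le_ne_top hβt (hk.le_of_lt x hxI β hβ hx')
  have hval : ∀ y, x < y → y ≤ β → clamp h α β y = (h y).toReal := fun y hy hy' => by
    rw [clamp, min_eq_left hy', max_eq_right (hx.trans hy.le)]
  refine le_antisymm ?_ ?_
  · refine le_of_forall_gt_imp_ge_of_dense fun c hc => ?_
    have hc0 : 0 < c := lt_of_le_of_lt ENNReal.toReal_nonneg hc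
    obtain ⟨y, hyI, hxy, hyc⟩ := hk.exists_lt x hxI (ENNReal.ofReal c)
      (by rwa [ENNReal.lt_ofReal_iff_toReal_lt hkt])
    have hy : x < min y β := lt_min hxy hx'
    refine (hmono.rightLim_le hy).trans ?_
    rw [hval _ hy (min_le_right _ _)]
    refine ENNReal.toReal_le_of_le_ofReal hc0.le (le_trans (hh (min_le_left _ _)) hyc.le)
  · refine ge_of_tendsto (hmono.tendsto_rightLim x) ?_
    filter_upwards [Ioo_mem_nhdsGT hx'] with y hy
    rw [hval y hy.1 hy.2.le]
    have hyI : y ∈ I := hI.out hα hβ ⟨hx.trans hy.1.le, hy.2.le⟩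
    exact ENNReal.toReal_mono (ne_top_of_le_ne_top hβt (hh hy.2.le))
      (hk.le_of_lt x hxI y hyI hy.1)

theorem measure_clamp_Ioc {I : Set ℝ} (hI : I.OrdConnected) {h k : ℝ → ℝ≥0∞} (hh : Monotone h)
    (hk : IsRightRegularization I h k) {α β : ℝ} (hα : α ∈ I) (hβ : β ∈ I) (hαβ : α ≤ β)
    (hβt : h β ≠ ∞) {x : ℝ} (hx : α ≤ x) (hx' : x < β) :
    (clamp_monotone hh hαβ hβt).stieltjesFunction.measure (Ioc α x) = k x - k α := by
  have hxI : x ∈ I := hI.out hα hβ ⟨hx, hx'.le⟩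
  have hkα : k α ≠ ∞ := ne_top_of_le_ne_top hβt (hk.le_of_lt α hα β hβ (hx.trans_lt hx'))
  have hkx : k x ≠ ∞ := ne_top_of_le_ne_top hβt (hk.le_of_lt x hxI β hβ hx')
  rw [StieltjesFunction.measure_Ioc, Monotone.stieltjesFunction_eq, Monotone.stieltjesFunction_eq,
    rightLim_clamp hI hh hk hα hβ hαβ hβt hx hx',
    rightLim_clamp hI hh hk hα hβ hαβ hβt le_rfl (hx.trans_lt hx'),
    ENNReal.ofReal_sub _ ENNReal.toReal_nonneg, ENNReal.ofReal_toReal hkx,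
    ENNReal.ofReal_toReal hkα]

/-- The superlevel set `{x ∈ I | 2 ^ j ≤ v x}`. -/
def superlevel (I : Set ℝ) (v : ℝ → ℝ≥0∞) (j : ℤ) : Set ℝ := {x | x ∈ I ∧ dyad j ≤ v x}

/-- The dyadic sum `∑_j (2 ^ j ‖w‖_{p,{v ≥ 2 ^ j},μ}) ^ r`, a discrete form of the integral
`∫ ‖w‖_{p,[x,b),μ} ^ r d(v ^ r)` including the mass of `v ^ r` at the left endpoint. -/
noncomputable def dyadicSum (p : ℝ≥0∞) (r : ℝ) (I : Set ℝ) (v : ℝ → ℝ≥0∞) (μ : Measure ℝ)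
    (w : ℝ → ℝ≥0∞) : ℝ≥0∞ :=
  ∑' j, (dyad j * lpNorm p (superlevel I v j) μ w) ^ r

section

variable {p : ℝ≥0∞} {r : ℝ} {I : Set ℝ} {v h : ℝ → ℝ≥0∞} {μ : Measure ℝ} {w : ℝ → ℝ≥0∞}

theorem superlevel_subset (j : ℤ) : superlevel I v j ⊆ I := fun _ hx => hx.1

theorem superlevel_anti {i j : ℤ} (hij : i ≤ j) : superlevel I v j ⊆ superlevel I v i :=
  fun _ hx => ⟨hx.1, (dyad_mono hij).trans hx.2⟩

theorem measurableSet_superlevel (hI : MeasurableSet I) (hv : Monotone v) (j : ℤ) :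
    MeasurableSet (superlevel I v j) :=
  hI.inter (measurableSet_le measurable_const hv.measurable)

theorem inter_Ici_subset_superlevel (hv : Monotone v) {x : ℝ} {j : ℤ} (hx : dyad j ≤ v x) :
    I ∩ Ici x ⊆ superlevel I v j := fun _ hy => ⟨hy.1, hx.trans (hv hy.2)⟩

/-- If every dyadic level carries at least the norm `c`, then `c` vanishes unless the dyadic sum
diverges. -/
theorem eq_zero_of_dyadicSum_ne_top (hr : 0 < r) {c : ℝ≥0∞}
    (hX : dyadicSum p r I v μ w ≠ ∞) (hc : ∀ j, c ≤ lpNorm p (superlevel I v j) μ w) : c = 0 := by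
  by_contra h0
  refine hX (top_unique ?_)
  calc (∞ : ℝ≥0∞) = (∑' j, dyad j ^ r) * c ^ r := by
        rw [tsum_dyad_rpow hr, ENNReal.top_mul]
        simp [ENNReal.rpow_eq_zero_iff, h0, hr.le]
    _ = ∑' j, (dyad j * c) ^ r := by
        rw [← ENNReal.tsum_mul_right]
        simp only [ENNReal.mul_rpow_of_nonneg _ _ hr.le]
    _ ≤ dyadicSum p r I v μ w := ENNReal.tsum_le_tsum fun j =>
        ENNReal.rpow_le_rpow (mul_le_mul' le_rfl (hc j)) hr.le

/-- The layer `{2 ^ j ≤ v < 2 ^ (j + 1)}` has Stieltjes measure at most `2 ^ ((j + 1) r)`. -/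
theorem lintegral_clamp_le_dyadicSum (hr : 0 < r) (hI : I.OrdConnected) (hv : Monotone v)
    (hv0 : ∀ x ∈ I, v x ≠ 0) (hh : Monotone h)
    (hk : IsRightRegularization I h fun x => v x ^ r) {α β : ℝ} (hα : α ∈ I) (hβ : β ∈ I)
    (hαβ : α ≤ β) (hβt : h β ≠ ∞) :
    ∫⁻ x in Ioo α β, tailNorm p I μ w x ^ r
        ∂(clamp_monotone hh hαβ hβt).stieltjesFunction.measure ≤
      2 ^ r * dyadicSum p r I v μ w := by
  set l := (clamp_monotone hh hαβ hβt).stieltjesFunction.measure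
  set C : ℤ → Set ℝ := fun j => {x | x ∈ Ioo α β ∧ dyad j ≤ v x ∧ v x < dyad (j + 1)}
  have hIoo : Ioo α β ⊆ I := fun x hx => hI.out hα hβ ⟨hx.1.le, hx.2.le⟩
  have hCm : ∀ j, MeasurableSet (C j) := fun j => measurableSet_Ioo.inter
    ((measurableSet_le measurable_const hv.measurable).inter
      (measurableSet_lt hv.measurable measurable_const))
  have hcov : Ioo α β ⊆ ⋃ j, C j := fun x hx => by
    have hxt : v x ≠ ∞ := fun hxt => by
      refine hβt (top_unique ?_)
      have := hk.le_of_lt x (hIoo hx) β hβ hx.2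
      simpa [hxt, ENNReal.top_rpow_of_pos hr] using this
    obtain ⟨j, hj1, hj2⟩ := exists_mem_Ico_dyad (hv0 x (hIoo hx)) hxt
    exact mem_iUnion_of_mem j ⟨hx, hj1, hj2⟩
  have hC : ∀ j, l (C j) ≤ dyad (j + 1) ^ r := fun j => by
    refine measure_le_of_forall_inter_Iic_le l fun x hx => ?_
    have hsub : C j ∩ Iic x ⊆ Ioc α x := fun y hy => ⟨hy.1.1.1, hy.2⟩
    refine (measure_mono hsub).trans ?_
    rw [measure_clamp_Ioc hI hh hk hα hβ hαβ hβt hx.1.1.le hx.1.2]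
    exact tsub_le_self.trans (ENNReal.rpow_le_rpow hx.2.2.le hr.le)
  calc ∫⁻ x in Ioo α β, tailNorm p I μ w x ^ r ∂l
      ≤ ∫⁻ x in ⋃ j, C j, tailNorm p I μ w x ^ r ∂l := lintegral_mono_set hcov
    _ ≤ ∑' j, ∫⁻ x in C j, tailNorm p I μ w x ^ r ∂l := lintegral_iUnion_le _ _
    _ ≤ ∑' j, 2 ^ r * (dyad j * lpNorm p (superlevel I v j) μ w) ^ r := by
        refine ENNReal.tsum_le_tsum fun j => ?_
        calc ∫⁻ x in C j, tailNorm p I μ w x ^ r ∂l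
            ≤ ∫⁻ _ in C j, lpNorm p (superlevel I v j) μ w ^ r ∂l := by
              refine setLIntegral_mono' (hCm j) fun x hx => ENNReal.rpow_le_rpow ?_ hr.le
              exact lpNorm_mono_set (inter_Ici_subset_superlevel hv hx.2.1)
          _ ≤ lpNorm p (superlevel I v j) μ w ^ r * dyad (j + 1) ^ r := by
              rw [setLIntegral_const]
              exact mul_le_mul' le_rfl (hC j)
          _ = 2 ^ r * (dyad j * lpNorm p (superlevel I v j) μ w) ^ r := by
              rw [dyad_succ]
              simp only [ENNReal.mul_rpow_of_nonneg _ _ hr.le]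
              ring
    _ = 2 ^ r * dyadicSum p r I v μ w := by rw [ENNReal.tsum_mul_left, dyadicSum]

theorem stieltjesIntegral_le_dyadicSum (hr : 0 < r) (hI : I.OrdConnected) (hv : Monotone v)
    (hv0 : ∀ x ∈ I, v x ≠ 0) (hh : Monotone h)
    (hk : IsRightRegularization I h fun x => v x ^ r) :
    stieltjesIntegral I (fun x => tailNorm p I μ w x ^ r) h hh ≤
      2 ^ r * dyadicSum p r I v μ w := by
  rcases eq_or_ne (dyadicSum p r I v μ w) ∞ with hX | hX
  · rw [hX, ENNReal.mul_top (two_rpow_ne_zero r)]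
    exact le_top
  rw [stieltjesIntegral, if_pos]
  · exact iSup_le fun α => iSup_le fun β => iSup_le fun hα => iSup_le fun hβ => iSup_le fun hαβ =>
      iSup_le fun hβt => lintegral_clamp_le_dyadicSum hr hI hv hv0 hh hk hα hβ hαβ hβt
  · intro x hx hxy
    have hvx : v x = ∞ := by
      by_contra hvx
      obtain ⟨y, hy, hxy', hlt⟩ := hk.exists_lt x hx ∞
        (ENNReal.rpow_lt_top_of_nonneg hr.le hvx)
      exact hlt.ne (hxy y hy hxy')
    have : tailNorm p I μ w x = 0 := eq_zero_of_dyadicSum_ne_top hr hX fun j =>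
      lpNorm_mono_set (inter_Ici_subset_superlevel hv (by simp [hvx]))
    simp [this, ENNReal.zero_rpow_of_pos hr]

theorem lpNorm_mul_le_dyadicSum (hr : 0 < r) {v₀ : ℝ≥0∞} (hv₀ : ∀ x ∈ I, v₀ ≤ v x) :
    (lpNorm p I μ w * v₀) ^ r ≤ 2 ^ r * dyadicSum p r I v μ w := by
  have hsub : ∀ j, dyad j ≤ v₀ → lpNorm p I μ w ≤ lpNorm p (superlevel I v j) μ w := fun j hj =>
    lpNorm_mono_set fun x hx => ⟨hx, hj.trans (hv₀ x hx)⟩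
  rcases eq_or_ne (dyadicSum p r I v μ w) ∞ with hX | hX
  · rw [hX, ENNReal.mul_top (two_rpow_ne_zero r)]
    exact le_top
  rcases eq_or_ne v₀ 0 with rfl | h0
  · simp [ENNReal.zero_rpow_of_pos hr]
  rcases eq_or_ne v₀ ∞ with rfl | ht
  · simp [eq_zero_of_dyadicSum_ne_top hr hX fun j => hsub j le_top, ENNReal.zero_rpow_of_pos hr]
  obtain ⟨j, hj1, hj2⟩ := exists_mem_Ico_dyad h0 ht
  calc (lpNorm p I μ w * v₀) ^ r
      ≤ (lpNorm p (superlevel I v j) μ w * (2 * dyad j)) ^ r := by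
        rw [← dyad_succ]
        exact ENNReal.rpow_le_rpow (mul_le_mul' (hsub j hj1) hj2.le) hr.le
    _ = 2 ^ r * (dyad j * lpNorm p (superlevel I v j) μ w) ^ r := by
        simp only [ENNReal.mul_rpow_of_nonneg _ _ hr.le]
        ring
    _ ≤ 2 ^ r * dyadicSum p r I v μ w := by
        gcongr
        exact ENNReal.le_tsum (f := fun j => (dyad j * lpNorm p (superlevel I v j) μ w) ^ r) j

theorem dyadicSum_le_tsum_prod (hr : 0 < r) :
    dyadicSum p r I v μ w ≤ 2 ^ r * ∑' s : ℤ × ℤ,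
      {s : ℤ × ℤ | dyad s.2 < lpNorm p (superlevel I v s.1) μ w}.indicator
        (fun s => dyad s.1 ^ r * dyad s.2 ^ r) s := by
  rw [ENNReal.tsum_prod', ← ENNReal.tsum_mul_left]
  refine ENNReal.tsum_le_tsum fun j => ?_
  rw [ENNReal.mul_rpow_of_nonneg _ _ hr.le]
  calc dyad j ^ r * lpNorm p (superlevel I v j) μ w ^ r
      ≤ dyad j ^ r * (2 ^ r * layerSum r (lpNorm p (superlevel I v j) μ w)) :=
        mul_le_mul' le_rfl (rpow_le_layerSum hr _)
    _ = 2 ^ r * ∑' k, dyad j ^ r * {k | dyad k < lpNorm p (superlevel I v j) μ w}.indicator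
          (fun k => dyad k ^ r) k := by
        rw [layerSum, ENNReal.tsum_mul_left]; ring
    _ = _ := by
        congr 1
        refine tsum_congr fun k => ?_
        by_cases hk : dyad k < lpNorm p (superlevel I v j) μ w <;> simp [indicator, hk]

/-- The finite part of the comparison of the dyadic sum with the Stieltjes integral: for finitely
many pairs `(j, k)` one window `(α, β)` carries enough of the Stieltjes measure. -/
theorem exists_window (hp : p ≠ 0) (hr : 0 < r) (hI : I.OrdConnected)
    (hmin : ∀ x ∈ I, ∃ y ∈ I, y < x) (hv : Monotone v) (hh : Monotone h)
    (hk : IsRightRegularization I h fun x => v x ^ r) (hw : Measurable w) {v₀ : ℝ≥0∞}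
    (hv₀ : ∀ c, v₀ < c → ∃ x ∈ I, v x < c)
    (hcond : ∀ x ∈ I, (∀ y ∈ I, x < y → h y = ∞) → tailNorm p I μ w x ^ r = 0)
    {S : Finset (ℤ × ℤ)} (hS : S.Nonempty)
    (hSk : ∀ s ∈ S, dyad s.2 < lpNorm p (superlevel I v s.1) μ w) :
    ∃ α β, ∃ (_ : α ∈ I) (_ : β ∈ I) (hαβ : α ≤ β) (hβt : h β ≠ ∞), ∀ s ∈ S,
      dyad s.1 ^ r ≤ 2 * (v₀ ^ r + (clamp_monotone hh hαβ hβt).stieltjesFunction.measure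
        (Ioo α β ∩ {x | dyad s.2 < tailNorm p I μ w x})) := by
  have hx : ∀ s ∈ S, ∃ x ∈ superlevel I v s.1, dyad s.2 < tailNorm p I μ w x := fun s hs => by
    by_contra! hx
    refine absurd (hSk s hs) (not_lt.2 (lpNorm_le_of_forall_inter_Ici_le hp
      (measurableSet_superlevel hI.measurableSet hv _) hw fun x hxs => ?_))
    exact (lpNorm_mono_set (inter_subset_inter_left _ (superlevel_subset _))).trans (hx x hxs)
  have hβ : ∀ s ∈ S, ∀ x ∈ I, dyad s.2 < tailNorm p I μ w x → ∃ β ∈ I, x < β ∧ h β ≠ ∞ :=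
    fun s _ x hx hlt => by
      by_contra! hcon
      have := hcond x hx hcon
      rw [ENNReal.rpow_eq_zero_iff_of_pos hr] at this
      simp [this] at hlt
  have hα : ∀ s ∈ S, ∀ x ∈ I, ∃ α ∈ I, α < x ∧ v α ^ r ≤ v₀ ^ r + dyad s.1 ^ r / 2 :=
    fun s _ x hx => by
      obtain ⟨z, hz, hzx⟩ := hmin x hx
      rcases eq_or_ne v₀ ∞ with rfl | hvt
      · exact ⟨z, hz, hzx, by simp [ENNReal.top_rpow_of_pos hr]⟩
      have hlt : v₀ ^ r < v₀ ^ r + dyad s.1 ^ r / 2 :=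
        ENNReal.lt_add_right (ENNReal.rpow_ne_top_of_nonneg hr.le hvt)
          (ENNReal.div_pos (dyad_rpow_ne_zero _ _) ENNReal.ofNat_ne_top).ne'
      obtain ⟨y, hy, hyc⟩ := hv₀ ((v₀ ^ r + dyad s.1 ^ r / 2) ^ r⁻¹) (by
        rwa [ENNReal.lt_rpow_inv_iff hr])
      rw [ENNReal.lt_rpow_inv_iff hr] at hyc
      rcases le_total y z with h | h
      · exact ⟨y, hy, h.trans_lt hzx, hyc.le⟩
      · exact ⟨z, hz, hzx, (ENNReal.rpow_le_rpow (hv h) hr.le).trans hyc.le⟩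
  -- `x s` carries the level `2 ^ k`; `α s` absorbs the mass of the left endpoint up to half of
  -- `2 ^ (j r)`; `β s` keeps `x s` inside a window where `h` is finite.
  choose! x hxs hxk using hx
  choose! β hβI hxβ hβt using fun s hs => hβ s hs (x s) (hxs s hs).1 (hxk s hs)
  choose! α hαI hαx hαv using fun s hs => hα s hs (x s) (hxs s hs).1
  obtain ⟨a, ha, ha'⟩ := S.exists_min_image α hS
  obtain ⟨b, hb, hb'⟩ := S.exists_max_image β hS
  have hab : α a ≤ β b := ((hαx a ha).trans (hxβ a ha)).le.trans (hb' a ha)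
  refine ⟨α a, β b, hαI a ha, hβI b hb, hab, hβt b hb, fun s hs => ?_⟩
  set l := (clamp_monotone hh hab (hβt b hb)).stieltjesFunction.measure
  have h1 : α a < x s := (ha' s hs).trans_lt (hαx s hs)
  have h2 : x s < β b := (hxβ s hs).trans_le (hb' s hs)
  have hsub : Ioc (α a) (x s) ⊆ Ioo (α a) (β b) ∩ {x | dyad s.2 < tailNorm p I μ w x} :=
    fun y hy => ⟨⟨hy.1, hy.2.trans_lt h2⟩,
      (hxk s hs).trans_le (tailNorm_antitone p I μ w hy.2)⟩
  have h3 : dyad s.1 ^ r ≤ v₀ ^ r + dyad s.1 ^ r / 2 +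
      l (Ioo (α a) (β b) ∩ {x | dyad s.2 < tailNorm p I μ w x}) := by
    calc dyad s.1 ^ r ≤ v (x s) ^ r := ENNReal.rpow_le_rpow (hxs s hs).2 hr.le
      _ ≤ v (α a) ^ r + (v (x s) ^ r - v (α a) ^ r) := le_add_tsub
      _ = v (α a) ^ r + l (Ioc (α a) (x s)) := by
          rw [measure_clamp_Ioc hI hh hk (hαI a ha) (hβI b hb) hab (hβt b hb) h1.le h2]
      _ ≤ _ := by
          refine add_le_add ?_ (measure_mono hsub)
          exact (ENNReal.rpow_le_rpow (hv (ha' s hs)) hr.le).trans (hαv s hs)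
  have hhalf : dyad s.1 ^ r / 2 ≠ ∞ := ENNReal.div_ne_top (dyad_rpow_ne_top _ _) two_ne_zero
  have h4 : dyad s.1 ^ r / 2 ≤ v₀ ^ r +
      l (Ioo (α a) (β b) ∩ {x | dyad s.2 < tailNorm p I μ w x}) := by
    rw [← ENNReal.add_le_add_iff_right hhalf, ENNReal.add_halves]
    refine h3.trans (le_of_eq ?_)
    ring
  calc dyad s.1 ^ r = 2 * (dyad s.1 ^ r / 2) := by
        rw [ENNReal.mul_div_cancel two_ne_zero ENNReal.ofNat_ne_top]
    _ ≤ _ := mul_le_mul' le_rfl h4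

/-- Both `‖w‖_{p,T_j} ^ r` and `‖w‖_{p,[x,b)} ^ r` are decomposed into dyadic levels `2 ^ k`; for each
`k` the sum over `j` is geometric, so one estimate of the Stieltjes mass of
`{x | ‖w‖_{p,[x,b)} > 2 ^ k}` suffices. -/
theorem dyadicSum_le (hp : p ≠ 0) (hr : 0 < r) (hI : I.OrdConnected)
    (hmin : ∀ x ∈ I, ∃ y ∈ I, y < x) (hv : Monotone v) (hh : Monotone h)
    (hk : IsRightRegularization I h fun x => v x ^ r) (hw : Measurable w) {v₀ : ℝ≥0∞}
    (hv₀ : ∀ c, v₀ < c → ∃ x ∈ I, v x < c) :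
    dyadicSum p r I v μ w ≤ 2 ^ r * (2 * geomConst r ^ 2) *
      (stieltjesIntegral I (fun x => tailNorm p I μ w x ^ r) h hh + (lpNorm p I μ w * v₀) ^ r) := by
  have hconst : (2 : ℝ≥0∞) ^ r * (2 * geomConst r ^ 2) ≠ 0 :=
    mul_ne_zero (two_rpow_ne_zero r) (mul_ne_zero two_ne_zero (pow_ne_zero _ (geomConst_ne_zero r)))
  by_cases hcond : ∀ x ∈ I, (∀ y ∈ I, x < y → h y = ∞) → tailNorm p I μ w x ^ r = 0
  swap
  · rw [stieltjesIntegral, if_neg hcond, top_add, ENNReal.mul_top hconst]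
    exact le_top
  refine (dyadicSum_le_tsum_prod hr).trans ?_
  rw [mul_assoc]
  refine mul_le_mul' le_rfl ?_
  rw [ENNReal.tsum_eq_iSup_sum]
  refine iSup_le fun S₀ => ?_
  classical
  set S := S₀.filter fun s => dyad s.2 < lpNorm p (superlevel I v s.1) μ w with hS
  have hsum : ∑ s ∈ S₀, {s : ℤ × ℤ | dyad s.2 < lpNorm p (superlevel I v s.1) μ w}.indicator
      (fun s => dyad s.1 ^ r * dyad s.2 ^ r) s = ∑ s ∈ S, dyad s.1 ^ r * dyad s.2 ^ r := by
    rw [hS, Finset.sum_filter]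
    exact Finset.sum_congr rfl fun s _ => by simp [indicator]
  rw [hsum]
  rcases S.eq_empty_or_nonempty with hemp | hne
  · rw [hemp, Finset.sum_empty]
    exact zero_le
  have hSk : ∀ s ∈ S, dyad s.2 < lpNorm p (superlevel I v s.1) μ w := fun s hs =>
    (Finset.mem_filter.1 hs).2
  obtain ⟨α, β, hα, hβ, hαβ, hβt, hwin⟩ :=
    exists_window hp hr hI hmin hv hh hk hw hv₀ hcond hne hSk
  set l := (clamp_monotone hh hαβ hβt).stieltjesFunction.measure
  have hWm : Measurable (tailNorm p I μ w) := (tailNorm_antitone p I μ w).measurable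
  calc ∑ s ∈ S, dyad s.1 ^ r * dyad s.2 ^ r
      = ∑' k, (∑' j, {j | (j, k) ∈ S}.indicator (fun j => dyad j ^ r) j) * dyad k ^ r := by
        simp only [← ENNReal.tsum_mul_right]
        rw [ENNReal.tsum_comm, ← ENNReal.tsum_prod
          (f := fun j k => {j | (j, k) ∈ S}.indicator (fun j => dyad j ^ r) j * dyad k ^ r),
          sum_eq_tsum_indicator]
        refine tsum_congr fun s => ?_
        by_cases hs : s ∈ S <;> simp [indicator, hs]
    _ ≤ ∑' k, 2 * geomConst r *
          ({k | dyad k < lpNorm p I μ w}.indicator (fun k => dyad k ^ r) k * v₀ ^ r +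
            dyad k ^ r * l (Ioo α β ∩ {x | dyad k < tailNorm p I μ w x})) := by
        refine ENNReal.tsum_le_tsum fun k => ?_
        by_cases hk' : ∃ j, (j, k) ∈ S
        · obtain ⟨j, hj⟩ := hk'
          have hkI : dyad k < lpNorm p I μ w :=
            (hSk _ hj).trans_le (lpNorm_mono_set (superlevel_subset _))
          have hsub := tsum_dyad_le hr (P := {j | (j, k) ∈ S})
            (M := 2 * (v₀ ^ r + l (Ioo α β ∩ {x | dyad k < tailNorm p I μ w x})))
            fun j hj => hwin (j, k) hj
          refine (mul_le_mul' hsub le_rfl).trans (le_of_eq ?_)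
          simp only [indicator, mem_ofPred_eq, hkI, if_true]
          ring
        · push Not at hk'
          simp [hk']
    _ = 2 * geomConst r * (layerSum r (lpNorm p I μ w) * v₀ ^ r +
          ∑' k, dyad k ^ r * l (Ioo α β ∩ {x | dyad k < tailNorm p I μ w x})) := by
        rw [ENNReal.tsum_mul_left, ENNReal.tsum_add, ENNReal.tsum_mul_right, layerSum]
    _ ≤ 2 * geomConst r * (geomConst r * lpNorm p I μ w ^ r * v₀ ^ r +
          geomConst r * ∫⁻ x in Ioo α β, tailNorm p I μ w x ^ r ∂l) := by
        refine mul_le_mul' le_rfl (add_le_add (mul_le_mul' (layerSum_le hr _) le_rfl) ?_)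
        exact tsum_dyad_mul_measure_le l _ hWm hr
    _ = 2 * geomConst r ^ 2 * ((∫⁻ x in Ioo α β, tailNorm p I μ w x ^ r ∂l) +
          (lpNorm p I μ w * v₀) ^ r) := by
        rw [ENNReal.mul_rpow_of_nonneg _ _ hr.le]
        ring
    _ ≤ _ := by
        refine mul_le_mul' le_rfl (add_le_add ?_ le_rfl)
        rw [stieltjesIntegral, if_pos hcond]
        exact le_iSup_of_le α <| le_iSup_of_le β <| le_iSup_of_le hα <| le_iSup_of_le hβ <|
          le_iSup_of_le hαβ <| le_iSup_of_le hβt le_rfl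

end

/-! ### The reciprocal tail norm and its right regularization property -/

/-- The non-decreasing function `x ↦ ‖u‖_{q,(x,b),ν}⁻¹`, with `0⁻¹ = ∞` and `∞⁻¹ = 0`. -/
noncomputable def tailRecip (q : ℝ≥0∞) (I : Set ℝ) (ν : Measure ℝ) (u : ℝ → ℝ≥0∞) (x : ℝ) :
    ℝ≥0∞ := (openTailNorm q I ν u x)⁻¹

section

variable {p q : ℝ≥0∞} {r : ℝ} {I : Set ℝ} {μ ν : Measure ℝ} {u w : ℝ → ℝ≥0∞}

theorem openTailNorm_antitone : Antitone (openTailNorm q I ν u) := fun _ _ hxy =>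
  lpNorm_mono_set (inter_subset_inter_right I (Ioi_subset_Ioi hxy))

theorem tailRecip_monotone : Monotone (tailRecip q I ν u) := fun _ _ hxy =>
  ENNReal.inv_le_inv.2 (openTailNorm_antitone hxy)

theorem openTailNorm_le_tailNorm (x : ℝ) : openTailNorm q I ν u x ≤ tailNorm q I ν u x :=
  lpNorm_mono_set (inter_subset_inter_right I Ioi_subset_Ici_self)

theorem tailNorm_le_openTailNorm {x y : ℝ} (hxy : x < y) :
    tailNorm q I ν u y ≤ openTailNorm q I ν u x :=
  lpNorm_mono_set (inter_subset_inter_right I (Ici_subset_Ioi.2 hxy))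

theorem tailRecip_rpow (x : ℝ) : tailRecip q I ν u x ^ r = openTailNorm q I ν u x ^ (-r) := by
  rw [tailRecip, ENNReal.inv_rpow, ENNReal.rpow_neg]

theorem rpow_neg_le_rpow_neg (hr : 0 ≤ r) {x y : ℝ≥0∞} (h : x ≤ y) : y ^ (-r) ≤ x ^ (-r) := by
  rw [ENNReal.rpow_neg, ENNReal.rpow_neg, ENNReal.inv_le_inv]
  exact ENNReal.rpow_le_rpow h hr

theorem tailRecip_ne_zero (hu : ∀ t ∈ I, tailNorm q I ν u t < ∞) :
    ∀ x ∈ I, tailRecip q I ν u x ≠ 0 := fun x hx =>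
  ENNReal.inv_ne_zero.2 ((openTailNorm_le_tailNorm x).trans_lt (hu x hx)).ne

theorem isRightRegularization_tailNorm (hq : q ≠ 0) (hr : 0 < r) (hI : MeasurableSet I)
    (hu : Measurable u) :
    IsRightRegularization I (fun x => tailNorm q I ν u x ^ (-r))
      fun x => tailRecip q I ν u x ^ r where
  le_of_lt x _ y _ hxy := by
    rw [tailRecip_rpow]
    exact rpow_neg_le_rpow_neg hr.le (tailNorm_le_openTailNorm hxy)
  le x _ := by
    rw [tailRecip_rpow]
    exact rpow_neg_le_rpow_neg hr.le (openTailNorm_le_tailNorm x)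
  exists_lt x _ c hc := by
    by_contra! hcon
    have hcr : (c⁻¹ ^ r⁻¹) ^ (-r) = c := by
      rw [ENNReal.rpow_neg, ENNReal.rpow_inv_rpow hr.ne', inv_inv]
    refine absurd hc (not_lt.2 ?_)
    rw [tailRecip_rpow]
    conv_lhs => rw [← hcr]
    refine rpow_neg_le_rpow_neg hr.le (lpNorm_le_of_forall_inter_Ici_le hq
      (hI.inter measurableSet_Ioi) hu fun y hy => ?_)
    have h1 : lpNorm q (I ∩ Ioi x ∩ Ici y) ν u ≤ tailNorm q I ν u y :=
      lpNorm_mono_set (inter_subset_inter_left _ inter_subset_left)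
    refine h1.trans ?_
    rw [ENNReal.le_rpow_inv_iff hr, ENNReal.le_inv_iff_le_inv, ← ENNReal.rpow_neg]
    exact hcon y hy.1 hy.2

theorem isRightRegularization_leftLim (hq : q ≠ 0) (hr : 0 < r) (hI : MeasurableSet I)
    (hu : Measurable u) :
    IsRightRegularization I (fun x => Function.leftLim (tailNorm q I ν u) x ^ (-r))
      fun x => tailRecip q I ν u x ^ r where
  le_of_lt x _ y _ hxy := by
    rw [tailRecip_rpow]
    obtain ⟨z, hxz, hzy⟩ := exists_between hxy
    exact rpow_neg_le_rpow_neg hr.le (((tailNorm_antitone q I ν u).leftLim_le hzy).trans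
      (tailNorm_le_openTailNorm hxz))
  le x hx := (rpow_neg_le_rpow_neg hr.le ((tailNorm_antitone q I ν u).le_leftLim le_rfl)).trans
    ((isRightRegularization_tailNorm hq hr hI hu).le x hx)
  exists_lt x hx c hc := by
    obtain ⟨y, hy, hxy, hyc⟩ := (isRightRegularization_tailNorm hq hr hI hu).exists_lt x hx c hc
    exact ⟨y, hy, hxy, (rpow_neg_le_rpow_neg hr.le
      ((tailNorm_antitone q I ν u).le_leftLim le_rfl)).trans_lt hyc⟩

theorem inv_lpNorm_le_tailRecip (x : ℝ) : (lpNorm q I ν u)⁻¹ ≤ tailRecip q I ν u x :=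
  ENNReal.inv_le_inv.2 (lpNorm_mono_set inter_subset_left)

theorem exists_tailRecip_lt (hq : q ≠ 0) (hI : MeasurableSet I) (hmin : ∀ x ∈ I, ∃ y ∈ I, y < x)
    (hu : Measurable u) (c : ℝ≥0∞) (hc : (lpNorm q I ν u)⁻¹ < c) :
    ∃ x ∈ I, tailRecip q I ν u x < c := by
  by_contra! hcon
  refine absurd hc (not_lt.2 ?_)
  rw [ENNReal.le_inv_iff_le_inv]
  refine lpNorm_le_of_forall_inter_Ici_le hq hI hu fun x hx => ?_
  obtain ⟨y, hy, hyx⟩ := hmin x hx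
  exact (tailNorm_le_openTailNorm hyx).trans (ENNReal.le_inv_iff_le_inv.1 (hcon y hy))

/-- The constant in the upper estimate of the dyadic sum by the Stieltjes integral. -/
noncomputable def stieltjesConst (r : ℝ) : ℝ≥0∞ := (2 * (2 ^ r * (2 * geomConst r ^ 2))) ^ (1 / r)

theorem stieltjesConst_ne_top (hr : 0 < r) : stieltjesConst r ≠ ∞ := by
  refine ENNReal.rpow_ne_top_of_nonneg (by positivity) (ENNReal.mul_ne_top ENNReal.ofNat_ne_top
    (ENNReal.mul_ne_top (two_rpow_ne_top r) (ENNReal.mul_ne_top ENNReal.ofNat_ne_top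
      (ENNReal.pow_ne_top (geomConst_ne_top hr)))))

theorem stieltjes_add_le_dyadicSum (hr : 0 < r) (hI : I.OrdConnected)
    (hu : ∀ t ∈ I, tailNorm q I ν u t < ∞) {h : ℝ → ℝ≥0∞} (hh : Monotone h)
    (hk : IsRightRegularization I h fun x => tailRecip q I ν u x ^ r) :
    stieltjesIntegral I (fun x => tailNorm p I μ w x ^ r) h hh ^ (1 / r) +
      lpNorm p I μ w * (lpNorm q I ν u)⁻¹ ≤
      4 * dyadicSum p r I (tailRecip q I ν u) μ w ^ (1 / r) := by
  have hroot : (2 ^ r * dyadicSum p r I (tailRecip q I ν u) μ w) ^ (1 / r) =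
      2 * dyadicSum p r I (tailRecip q I ν u) μ w ^ (1 / r) := by
    rw [ENNReal.mul_rpow_of_nonneg _ _ (by positivity), ← ENNReal.rpow_mul,
      mul_one_div_cancel hr.ne', ENNReal.rpow_one]
  have h1 := stieltjesIntegral_le_dyadicSum (p := p) (μ := μ) (w := w) hr hI tailRecip_monotone
    (tailRecip_ne_zero hu) hh hk
  have h2 := lpNorm_mul_le_dyadicSum (p := p) (μ := μ) (w := w) (I := I) hr
    (v := tailRecip q I ν u) fun x _ => inv_lpNorm_le_tailRecip x
  rw [← ENNReal.le_rpow_inv_iff hr, ← one_div r, hroot] at h2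
  have h3 := ENNReal.rpow_le_rpow h1 (z := 1 / r) (by positivity)
  rw [hroot] at h3
  refine (add_le_add h3 h2).trans (le_of_eq ?_)
  ring

theorem dyadicSum_le_stieltjes_add (hp : p ≠ 0) (hq : q ≠ 0) (hr : 0 < r) (hI : I.OrdConnected)
    (hmin : ∀ x ∈ I, ∃ y ∈ I, y < x) (hu : Measurable u) (hw : Measurable w)
    {h : ℝ → ℝ≥0∞} (hh : Monotone h)
    (hk : IsRightRegularization I h fun x => tailRecip q I ν u x ^ r) :
    dyadicSum p r I (tailRecip q I ν u) μ w ^ (1 / r) ≤ stieltjesConst r *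
      (stieltjesIntegral I (fun x => tailNorm p I μ w x ^ r) h hh ^ (1 / r) +
        lpNorm p I μ w * (lpNorm q I ν u)⁻¹) := by
  have h1 := dyadicSum_le (μ := μ) hp hr hI hmin tailRecip_monotone hh hk hw
    (exists_tailRecip_lt hq hI.measurableSet hmin hu)
  set S := stieltjesIntegral I (fun x => tailNorm p I μ w x ^ r) h hh
  set N := lpNorm p I μ w * (lpNorm q I ν u)⁻¹
  have h2 : S + N ^ r ≤ 2 * (S ^ (1 / r) + N) ^ r := by
    rw [two_mul]
    refine add_le_add ?_ (ENNReal.rpow_le_rpow le_add_self hr.le)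
    calc S = (S ^ (1 / r)) ^ r := by
          rw [← ENNReal.rpow_mul, one_div_mul_cancel hr.ne', ENNReal.rpow_one]
      _ ≤ _ := ENNReal.rpow_le_rpow le_self_add hr.le
  calc dyadicSum p r I (tailRecip q I ν u) μ w ^ (1 / r)
      ≤ (2 * (2 ^ r * (2 * geomConst r ^ 2)) * (S ^ (1 / r) + N) ^ r) ^ (1 / r) := by
        refine ENNReal.rpow_le_rpow (h1.trans ((mul_le_mul' le_rfl h2).trans (le_of_eq ?_)))
          (by positivity)
        ring
    _ = stieltjesConst r * (S ^ (1 / r) + N) := by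
        rw [ENNReal.mul_rpow_of_nonneg _ _ (by positivity), ← ENNReal.rpow_mul,
          mul_one_div_cancel hr.ne', ENNReal.rpow_one, stieltjesConst]

/-! ### Test functions and running suprema -/

/-- Testing the inequality on the indicator of `[t, b)`. -/
theorem InequalityHolds.tailNorm_le {c : ℝ≥0} (hc : InequalityHolds p q I μ ν u w c)
    (hI : MeasurableSet I) (t : ℝ) :
    tailNorm p I μ w t ≤ c * openTailNorm q I ν u t := by
  have h := hc ((Ici t).indicator 1) (measurable_one.indicator measurableSet_Ici)
  have h1 : (fun x => (Ici t).indicator (1 : ℝ → ℝ≥0∞) x * w x) = (Ici t).indicator w := by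
    funext x
    by_cases hx : x ∈ Ici t <;> simp [hx]
  rw [h1, lpNorm_indicator measurableSet_Ici] at h
  refine h.trans (mul_le_mul' le_rfl ?_)
  rw [openTailNorm, ← lpNorm_indicator measurableSet_Ioi]
  refine lpNorm_mono hI fun x _ => ?_
  by_cases hx : x ∈ Ioi t
  · rw [indicator_of_mem hx]
    refine (mul_le_mul' le_rfl (lpNorm_top_le_iff.2 (ae_of_all _ fun y => ?_))).trans
      (mul_one (u x)).le
    exact indicator_le_self' (fun _ _ => zero_le) y
  · rw [indicator_of_notMem hx]
    refine (mul_le_mul' le_rfl (b := u x) (d := 0) ?_).trans (mul_zero (u x)).le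
    refine lpNorm_top_le_iff.2 (ae_restrict_of_forall_mem (hI.inter measurableSet_Iio)
      fun y hy => ?_)
    have hy' : y ∉ Ici t := fun h' => hx (mem_Ioi.2 ((mem_Ici.1 h').trans_lt hy.2))
    rw [indicator_of_notMem hy']

theorem InequalityHolds.mono {c c' : ℝ≥0} (hc : InequalityHolds p q I μ ν u w c) (h : c ≤ c') :
    InequalityHolds p q I μ ν u w c' := fun g hg =>
  (hc g hg).trans (mul_le_mul' (by exact_mod_cast h) le_rfl)

theorem lpNorm_superlevel_le (hp : p ≠ 0) (hI : MeasurableSet I) (hw : Measurable w) {c : ℝ≥0∞}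
    (hc : ∀ x ∈ I, tailNorm p I μ w x ≤ c * openTailNorm q I ν u x) (j : ℤ) :
    lpNorm p (superlevel I (tailRecip q I ν u) j) μ w ≤ c * (dyad j)⁻¹ := by
  refine lpNorm_le_of_forall_inter_Ici_le hp (measurableSet_superlevel hI tailRecip_monotone j) hw
    fun x hx => ?_
  refine (lpNorm_mono_set (inter_subset_inter_left _ (superlevel_subset j))).trans
    ((hc x hx.1).trans (mul_le_mul' le_rfl ?_))
  exact ENNReal.le_inv_iff_le_inv.1 hx.2

/-- The right-hand side of the inequality controls `‖g‖_{∞,(a,x],μ} ‖u‖_{q,(x,b),ν}`. -/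
theorem mul_openTailNorm_le (hq : q ≠ 0) (hI : MeasurableSet I) (hu : Measurable u)
    (g : ℝ → ℝ≥0∞) (x : ℝ) :
    lpNorm ∞ (I ∩ Iic x) μ g * openTailNorm q I ν u x ≤
      lpNorm q I ν fun y => u y * lpNorm ∞ (I ∩ Iio y) μ g := by
  rw [openTailNorm, ← lpNorm_const_mul hq hu]
  refine le_trans ?_ (lpNorm_mono_set (E := I ∩ Ioi x) inter_subset_left)
  refine lpNorm_mono (hI.inter measurableSet_Ioi) fun y hy => ?_
  rw [mul_comm]
  exact mul_le_mul' le_rfl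
    (lpNorm_mono_set (inter_subset_inter_right I (Iic_subset_Iio.2 hy.2)))

theorem runningSup_monotone (g : ℝ → ℝ≥0∞) : Monotone fun x => lpNorm ∞ (I ∩ Iic x) μ g :=
  fun _ _ hxy => lpNorm_mono_set (inter_subset_inter_right I (Iic_subset_Iic.2 hxy))

theorem openRunningSup_monotone (g : ℝ → ℝ≥0∞) : Monotone fun x => lpNorm ∞ (I ∩ Iio x) μ g :=
  fun _ _ hxy => lpNorm_mono_set (inter_subset_inter_right I (Iio_subset_Iio hxy))

theorem lpNorm_mul_le_runningSup (hI : MeasurableSet I) (g : ℝ → ℝ≥0∞) :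
    lpNorm p I μ (fun x => g x * w x) ≤
      lpNorm p I μ fun x => lpNorm ∞ (I ∩ Iic x) μ g * w x := by
  refine lpNorm_mono_ae ?_
  filter_upwards [ae_le_lpNorm_top_inter_Iic hI (f := g) (μ := μ)] with x hx
  exact mul_le_mul' hx le_rfl

/-- The passage from two-sided estimates of all admissible constants to the best constant. -/
theorem bestConstant_equiv {B K₁ K₂ : ℝ≥0∞} {K : ℝ≥0} (hK1 : K₁ ≤ K) (hK2 : K₂ ≤ K) (hK : 0 < K)
    (h1 : B < ∞ → ∀ c : ℝ≥0, K₁ * B ≤ c → InequalityHolds p q I μ ν u w c)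
    (h2 : ∀ c : ℝ≥0, InequalityHolds p q I μ ν u w c → B ≤ K₂ * c) :
    ((∃ c : ℝ≥0, 0 < c ∧ InequalityHolds p q I μ ν u w c) ↔ B < ∞) ∧
      bestConstant p q I μ ν u w ≤ K * B ∧ B ≤ K * bestConstant p q I μ ν u w := by
  have hK0 : (K : ℝ≥0∞) ≠ 0 := by exact_mod_cast hK.ne'
  have hfin : B < ∞ → InequalityHolds p q I μ ν u w (K * B).toNNReal := fun hB => by
    refine h1 hB _ ?_
    rw [ENNReal.coe_toNNReal (ENNReal.mul_ne_top ENNReal.coe_ne_top hB.ne)]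
    exact mul_le_mul' hK1 le_rfl
  refine ⟨⟨fun ⟨c, _, hc⟩ => ?_, fun hB => ?_⟩, ?_, ?_⟩
  · exact (h2 c hc).trans_lt (ENNReal.mul_lt_top (hK2.trans_lt ENNReal.coe_lt_top)
      ENNReal.coe_lt_top)
  · exact ⟨(K * B).toNNReal + 1, by positivity, (hfin hB).mono le_self_add⟩
  · rcases eq_or_ne B ∞ with rfl | hB
    · rw [ENNReal.mul_top hK0]
      exact le_top
    · refine iInf₂_le_of_le _ (hfin hB.lt_top) ?_
      rw [ENNReal.coe_toNNReal (ENNReal.mul_ne_top ENNReal.coe_ne_top hB)]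
  · rw [mul_comm, ← ENNReal.div_le_iff hK0 ENNReal.coe_ne_top]
    refine le_iInf₂ fun c hc => ?_
    rw [ENNReal.div_le_iff hK0 ENNReal.coe_ne_top, mul_comm]
    exact (h2 c hc).trans (mul_le_mul' hK2 le_rfl)

end

section

variable {p q : ℝ≥0∞} {r : ℝ} {I : Set ℝ} {μ ν : Measure ℝ} {u w : ℝ → ℝ≥0∞}

/-! ### The case `q ≤ p` -/

theorem B₁_le {c : ℝ≥0} (hI : MeasurableSet I) (hc : InequalityHolds p q I μ ν u w c) :
    B₁ p q I μ ν u w ≤ c := by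
  refine lpNorm_top_le_iff.2 (ae_of_all _ fun x => ?_)
  rw [← div_eq_mul_inv]
  exact ENNReal.div_le_of_le_mul (hc.tailNorm_le hI x)

/-- The almost everywhere bound expressed by `B₁` holds everywhere. -/
theorem tailNorm_le_B₁_mul (hp : p ≠ 0) (hI : MeasurableSet I) (hw : Measurable w)
    (hu : ∀ t ∈ I, tailNorm q I ν u t < ∞) (hB : B₁ p q I μ ν u w < ∞) (t : ℝ) :
    tailNorm p I μ w t ≤ B₁ p q I μ ν u w * openTailNorm q I ν u t := by
  set P : Set ℝ := {x | tailNorm p I μ w x * (openTailNorm q I ν u x)⁻¹ ≤ B₁ p q I μ ν u w}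
  have hPm : MeasurableSet P := measurableSet_le
    ((tailNorm_antitone p I μ w).measurable.mul openTailNorm_antitone.measurable.inv)
    measurable_const
  have hP : ∀ᵐ x ∂μ.restrict (I ∩ Ici t), x ∈ P :=
    ae_restrict_of_ae_restrict_of_subset inter_subset_left
      (ae_le_lpNorm_top (f := fun x => tailNorm p I μ w x * (openTailNorm q I ν u x)⁻¹))
  have hPw : tailNorm p I μ w t ≤ lpNorm p (I ∩ Ici t ∩ P) μ w := by
    rw [← lpNorm_indicator hPm]
    refine lpNorm_mono_ae ?_
    filter_upwards [hP] with x hx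
    rw [indicator_of_mem hx]
  refine hPw.trans (lpNorm_le_of_forall_inter_Ici_le hp ((hI.inter measurableSet_Ici).inter hPm)
    hw fun x hx => ?_)
  have h1 : lpNorm p (I ∩ Ici t ∩ P ∩ Ici x) μ w ≤ tailNorm p I μ w x :=
    lpNorm_mono_set fun y hy => ⟨hy.1.1.1, hy.2⟩
  refine h1.trans (le_trans ?_ (mul_le_mul' le_rfl (openTailNorm_antitone hx.1.2)))
  have hxP : tailNorm p I μ w x * (openTailNorm q I ν u x)⁻¹ ≤ B₁ p q I μ ν u w := hx.2
  rw [← div_eq_mul_inv] at hxP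
  refine (ENNReal.div_le_iff_le_mul (Or.inr hB.ne) (Or.inl ?_)).1 hxP
  exact ((openTailNorm_le_tailNorm x).trans_lt (hu x hx.1.1)).ne

theorem lpNorm_le_of_tailNorm_le_top (hq : q ≠ 0) (hI : MeasurableSet I) (hu : Measurable u)
    {B : ℝ≥0∞} (hB : ∀ x, tailNorm ∞ I μ w x ≤ B * openTailNorm q I ν u x) (g : ℝ → ℝ≥0∞) :
    lpNorm ∞ I μ (fun x => g x * w x) ≤
      B * lpNorm q I ν fun x => u x * lpNorm ∞ (I ∩ Iio x) μ g := by
  refine (lpNorm_mul_le_runningSup hI g).trans (lpNorm_top_le_iff.2 ?_)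
  filter_upwards [ae_le_lpNorm_top_inter_Ici hI (f := w) (μ := μ)] with x hx
  calc lpNorm ∞ (I ∩ Iic x) μ g * w x
      ≤ lpNorm ∞ (I ∩ Iic x) μ g * (B * openTailNorm q I ν u x) :=
        mul_le_mul' le_rfl (hx.trans (hB x))
    _ = B * (lpNorm ∞ (I ∩ Iic x) μ g * openTailNorm q I ν u x) := by ring
    _ ≤ _ := mul_le_mul' le_rfl (mul_openTailNorm_le hq hI hu g x)

/-- For `q ≤ p < ∞` both sides of the inequality are discretized along the levels `2 ^ k` of the
running supremum of `g`, and the embedding `ℓ^q ⊆ ℓ^p` applies. -/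
theorem lpNorm_le_of_tailNorm_le (hp : p ≠ 0) (hp' : p ≠ ∞) (hq : q ≠ 0) (hqp : q ≤ p)
    (hI : MeasurableSet I) (hu : Measurable u) (hw : Measurable w)
    {B : ℝ≥0∞} (hB : ∀ x, tailNorm p I μ w x ≤ B * openTailNorm q I ν u x) (g : ℝ → ℝ≥0∞) :
    lpNorm p I μ (fun x => g x * w x) ≤
      2 * geomConst q.toReal ^ (1 / q.toReal) * B *
        lpNorm q I ν fun x => u x * lpNorm ∞ (I ∩ Iio x) μ g := by
  have hq' : q ≠ ∞ := ne_top_of_le_ne_top hp' hqp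
  have hP := ENNReal.toReal_pos hp hp'
  have hQ := ENNReal.toReal_pos hq hq'
  have hQP : q.toReal ≤ p.toReal := ENNReal.toReal_mono hp' hqp
  set P := p.toReal
  set Q := q.toReal
  set Gp : ℝ → ℝ≥0∞ := fun x => lpNorm ∞ (I ∩ Iic x) μ g
  set G : ℝ → ℝ≥0∞ := fun x => lpNorm ∞ (I ∩ Iio x) μ g
  have hGp : Measurable Gp := (runningSup_monotone g).measurable
  have hG : Measurable G := (openRunningSup_monotone g).measurable
  set E : ℤ → Set ℝ := fun k => I ∩ {x | dyad k < Gp x}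
  set E' : ℤ → Set ℝ := fun k => I ∩ {x | dyad k < G x}
  have hEm : ∀ k, MeasurableSet (E k) := fun k =>
    hI.inter (measurableSet_lt measurable_const hGp)
  have hEm' : ∀ k, MeasurableSet (E' k) := fun k =>
    hI.inter (measurableSet_lt measurable_const hG)
  have hEE' : ∀ k, lpNorm p (E k) μ w ≤ B * lpNorm q (E' k) ν u := fun k => by
    refine lpNorm_le_of_forall_inter_Ici_le hp (hEm k) hw fun x hx => ?_
    refine (lpNorm_mono_set (inter_subset_inter_left _ inter_subset_left)).trans
      ((hB x).trans (mul_le_mul' le_rfl (lpNorm_mono_set fun y hy => ⟨hy.1, ?_⟩)))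
    exact hx.2.trans_le (lpNorm_mono_set (inter_subset_inter_right I (Iic_subset_Iio.2 hy.2)))
  have hR : (lpNorm q I ν fun x => u x * G x) ^ Q =
      ∫⁻ x in I, G x ^ Q ∂ν.withDensity fun x => u x ^ Q := by
    rw [← lpNorm_mul_rpow hq hq' hI hu hG]
    simp only [mul_comm]
    rfl
  set R := lpNorm q I ν fun x => u x * G x
  have hsumR : ∑' k, (dyad k * lpNorm q (E' k) ν u) ^ Q ≤ geomConst Q * R ^ Q := by
    rw [hR]
    refine le_trans (le_of_eq (tsum_congr fun k => ?_)) (tsum_dyad_mul_measure_le _ I hG hQ)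
    rw [withDensity_eq_lpNorm hq hq' (hEm' k), ENNReal.mul_rpow_of_nonneg _ _ hQ.le]
  rw [← ENNReal.rpow_le_rpow_iff hP]
  calc lpNorm p I μ (fun x => g x * w x) ^ P
      ≤ lpNorm p I μ (fun x => Gp x * w x) ^ P :=
        ENNReal.rpow_le_rpow (lpNorm_mul_le_runningSup hI g) hP.le
    _ ≤ 2 ^ P * ∑' k, dyad k ^ P * (μ.withDensity fun x => w x ^ P) (E k) := by
        rw [lpNorm_mul_rpow hp hp' hI hw hGp]
        exact lintegral_rpow_le_tsum_dyad _ I hGp hP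
    _ ≤ 2 ^ P * ∑' k, B ^ P * ((dyad k * lpNorm q (E' k) ν u) ^ Q) ^ (P / Q) := by
        refine mul_le_mul' le_rfl (ENNReal.tsum_le_tsum fun k => ?_)
        rw [withDensity_eq_lpNorm hp hp' (hEm k), ← ENNReal.rpow_mul,
          mul_div_cancel₀ P hQ.ne', ← ENNReal.mul_rpow_of_nonneg _ _ hP.le,
          ← ENNReal.mul_rpow_of_nonneg _ _ hP.le]
        refine ENNReal.rpow_le_rpow ((mul_le_mul' le_rfl (hEE' k)).trans (le_of_eq ?_)) hP.le
        ring
    _ ≤ 2 ^ P * (B ^ P * (∑' k, (dyad k * lpNorm q (E' k) ν u) ^ Q) ^ (P / Q)) := by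
        rw [ENNReal.tsum_mul_left]
        exact mul_le_mul' le_rfl (mul_le_mul' le_rfl
          (tsum_rpow_le_rpow_tsum _ ((one_le_div hQ).2 hQP)))
    _ ≤ 2 ^ P * (B ^ P * (geomConst Q * R ^ Q) ^ (P / Q)) := by
        refine mul_le_mul' le_rfl (mul_le_mul' le_rfl (ENNReal.rpow_le_rpow hsumR (by positivity)))
    _ = (2 * geomConst Q ^ (1 / Q) * B * R) ^ P := by
        simp only [ENNReal.mul_rpow_of_nonneg _ _ hP.le]
        rw [ENNReal.mul_rpow_of_nonneg _ _ (by positivity), ← ENNReal.rpow_mul,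
          ← ENNReal.rpow_mul, mul_div_cancel₀ P hQ.ne', one_div_mul_eq_div]
        ring

theorem inequality_of_B₁ (hp : p ≠ 0) (hq : q ≠ 0) (hqp : q ≤ p)
    (hI : MeasurableSet I) (hu : Measurable u) (hw : Measurable w)
    (hut : ∀ t ∈ I, tailNorm q I ν u t < ∞) (hB : B₁ p q I μ ν u w < ∞) {c : ℝ≥0}
    (hc : (1 + 2 * geomConst q.toReal ^ (1 / q.toReal)) * B₁ p q I μ ν u w ≤ c) :
    InequalityHolds p q I μ ν u w c := fun g _ => by
  have hBt := tailNorm_le_B₁_mul hp hI hw hut hB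
  rcases eq_or_ne p ∞ with rfl | hp'
  · refine (lpNorm_le_of_tailNorm_le_top hq hI hu hBt g).trans (mul_le_mul' (le_trans ?_ hc) le_rfl)
    rw [add_mul, one_mul]
    exact le_self_add
  · refine (lpNorm_le_of_tailNorm_le hp hp' hq hqp hI hu hw hBt g).trans
      (mul_le_mul' (le_trans ?_ hc) le_rfl)
    exact mul_le_mul' le_add_self le_rfl

/-! ### The case `q = ∞` -/

theorem B₃_eq (hp : p ≠ 0) (hp' : p ≠ ∞) :
    B₃ p I μ ν u w = lpNorm p I μ fun x => tailRecip ∞ I ν u x * w x := by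
  have hP := ENNReal.toReal_pos hp hp'
  refine ENNReal.rpow_left_injective hP.ne' (?_ : _ ^ p.toReal = _ ^ p.toReal)
  rw [lpNorm_rpow hp hp', B₃, ← ENNReal.rpow_mul, one_div_mul_cancel hP.ne', ENNReal.rpow_one]
  simp only [tailRecip, div_eq_mul_inv, mul_comm]

/-- The extremal test function is `g = ‖u‖_{∞,(x,b),ν}⁻¹`. -/
theorem B₃_le (hp : p ≠ 0) (hp' : p ≠ ∞) (hI : MeasurableSet I) {c : ℝ≥0}
    (hc : InequalityHolds p ∞ I μ ν u w c) : B₃ p I μ ν u w ≤ c := by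
  rw [B₃_eq hp hp']
  refine (hc _ tailRecip_monotone.measurable).trans ((mul_le_mul' le_rfl ?_).trans
    (mul_one (c : ℝ≥0∞)).le)
  refine lpNorm_top_le_iff.2 ?_
  filter_upwards [ae_le_lpNorm_top_inter_Ici hI (f := u) (μ := ν),
    ae_restrict_mem hI] with x hx hxI
  have h1 : lpNorm ∞ (I ∩ Iio x) μ (tailRecip ∞ I ν u) ≤ (tailNorm ∞ I ν u x)⁻¹ :=
    lpNorm_top_le_iff.2 (ae_restrict_of_forall_mem (hI.inter measurableSet_Iio) fun y hy =>
      ENNReal.inv_le_inv.2 (tailNorm_le_openTailNorm hy.2))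
  calc u x * lpNorm ∞ (I ∩ Iio x) μ (tailRecip ∞ I ν u)
      ≤ tailNorm ∞ I ν u x * (tailNorm ∞ I ν u x)⁻¹ := mul_le_mul' hx h1
    _ ≤ 1 := ENNReal.mul_inv_le_one _

theorem inequality_of_B₃ (hp : p ≠ 0) (hp' : p ≠ ∞) (hI : MeasurableSet I) (hu : Measurable u)
    (hw : Measurable w) (hut : ∀ t ∈ I, tailNorm ∞ I ν u t < ∞) (hB : B₃ p I μ ν u w < ∞)
    {c : ℝ≥0} (hc : 1 * B₃ p I μ ν u w ≤ c) : InequalityHolds p ∞ I μ ν u w c := fun g _ => by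
  have hP := ENNReal.toReal_pos hp hp'
  refine le_trans ?_ (mul_le_mul' hc le_rfl)
  rw [one_mul, B₃_eq hp hp', mul_comm, ← lpNorm_const_mul hp
    (f := fun x => tailRecip ∞ I ν u x * w x) (tailRecip_monotone.measurable.mul hw)]
  refine (lpNorm_mul_le_runningSup hI g).trans (lpNorm_mono_ae ?_)
  have hfin : ∀ᵐ x ∂μ.restrict I, tailRecip ∞ I ν u x * w x < ∞ := by
    rw [B₃_eq hp hp'] at hB
    have h := (ENNReal.rpow_lt_top_of_nonneg hP.le hB.ne)
    rw [lpNorm_rpow hp hp'] at h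
    filter_upwards [ae_lt_top ((tailRecip_monotone.measurable.mul hw).pow_const _) h.ne] with x hx
    exact (ENNReal.rpow_lt_top_iff_of_pos hP).1 hx
  filter_upwards [hfin, ae_restrict_mem hI] with x hx hxI
  rcases eq_or_ne (openTailNorm ∞ I ν u x) 0 with h0 | h0
  · have hw0 : w x = 0 := by
      by_contra hw0
      simp [tailRecip, h0, ENNReal.top_mul hw0] at hx
    simp [hw0]
  · have ht := ((openTailNorm_le_tailNorm x).trans_lt (hut x hxI)).ne
    calc lpNorm ∞ (I ∩ Iic x) μ g * w x
        = lpNorm ∞ (I ∩ Iic x) μ g * openTailNorm ∞ I ν u x * (tailRecip ∞ I ν u x * w x) := by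
          rw [tailRecip, ← mul_assoc, mul_assoc (lpNorm ∞ (I ∩ Iic x) μ g),
            ENNReal.mul_inv_cancel h0 ht, mul_one]
      _ ≤ _ := mul_le_mul' (mul_openTailNorm_le ENNReal.top_ne_zero hI hu g x) le_rfl

theorem B₃_le_dyadicSum (hp : p ≠ 0) (hp' : p ≠ ∞) (hI : MeasurableSet I) (hw : Measurable w) :
    B₃ p I μ ν u w ≤
      2 * dyadicSum p p.toReal I (tailRecip ∞ I ν u) μ w ^ (1 / p.toReal) := by
  have hP := ENNReal.toReal_pos hp hp'
  rw [← ENNReal.rpow_le_rpow_iff hP, B₃_eq hp hp',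
    lpNorm_mul_rpow hp hp' hI hw tailRecip_monotone.measurable,
    ENNReal.mul_rpow_of_nonneg _ _ hP.le, ← ENNReal.rpow_mul, one_div_mul_cancel hP.ne',
    ENNReal.rpow_one]
  refine (lintegral_rpow_le_tsum_dyad _ I tailRecip_monotone.measurable hP).trans
    (mul_le_mul' le_rfl (ENNReal.tsum_le_tsum fun k => ?_))
  rw [ENNReal.mul_rpow_of_nonneg _ _ hP.le,
    ← withDensity_eq_lpNorm hp hp' (measurableSet_superlevel hI tailRecip_monotone k)]
  exact mul_le_mul' le_rfl (measure_mono fun x hx => ⟨hx.1, le_of_lt hx.2⟩)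

theorem dyadicSum_le_B₃ (hp : p ≠ 0) (hp' : p ≠ ∞) (hI : MeasurableSet I) (hw : Measurable w) :
    dyadicSum p p.toReal I (tailRecip ∞ I ν u) μ w ^ (1 / p.toReal) ≤
      2 * geomConst p.toReal ^ (1 / p.toReal) * B₃ p I μ ν u w := by
  have hP := ENNReal.toReal_pos hp hp'
  rw [← ENNReal.rpow_le_rpow_iff hP, ← ENNReal.rpow_mul, one_div_mul_cancel hP.ne',
    ENNReal.rpow_one, ENNReal.mul_rpow_of_nonneg _ _ hP.le, ENNReal.mul_rpow_of_nonneg _ _ hP.le,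
    ← ENNReal.rpow_mul, one_div_mul_cancel hP.ne', ENNReal.rpow_one, B₃_eq hp hp',
    lpNorm_mul_rpow hp hp' hI hw tailRecip_monotone.measurable, mul_assoc]
  refine le_trans ?_ (mul_le_mul' le_rfl
    (tsum_dyad_mul_measure_le _ I tailRecip_monotone.measurable hP))
  rw [dyadicSum, ← ENNReal.tsum_mul_left, ← (Equiv.addRight (1 : ℤ)).tsum_eq]
  refine ENNReal.tsum_le_tsum fun k => ?_
  rw [Equiv.coe_addRight, ENNReal.mul_rpow_of_nonneg _ _ hP.le, dyad_succ,
    ← withDensity_eq_lpNorm hp hp' (measurableSet_superlevel hI tailRecip_monotone _),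
    ENNReal.mul_rpow_of_nonneg _ _ hP.le, mul_assoc]
  refine mul_le_mul' le_rfl (mul_le_mul' le_rfl (measure_mono fun x hx => ⟨hx.1, ?_⟩))
  exact (dyad_lt_iff.2 (lt_add_one k)).trans_le hx.2

end

section

variable {p q : ℝ≥0∞} {r : ℝ} {I : Set ℝ} {μ ν : Measure ℝ} {u w : ℝ → ℝ≥0∞}

/-! ### Sufficiency for `p < q < ∞` -/

/-- The layer `{x ∈ I | 2 ^ j ≤ v x < 2 ^ (j + 1)}`. -/
def dyadicLayer (I : Set ℝ) (v : ℝ → ℝ≥0∞) (j : ℤ) : Set ℝ :=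
  {x | x ∈ I ∧ dyad j ≤ v x ∧ v x < dyad (j + 1)}

/-- The suprema of `Gp` over the dyadic layers of `v`, weighted by `2 ^ (-j)`, are controlled by
`∫ G ^ Q dn`. At each level `2 ^ k` of `Gp` the sum over `j` is geometric, so only the first layer
meeting `{Gp > 2 ^ k}` counts. -/
theorem tsum_iSup_dyadicLayer_le (n : Measure ℝ) {Q : ℝ} (hQ : 0 < Q) {v Gp G : ℝ → ℝ≥0∞}
    (hG : Measurable G) (hGpG : ∀ x y, x < y → Gp x ≤ G y)
    (hn : ∀ x ∈ I, (v x)⁻¹ ^ Q ≤ n (I ∩ Ioi x)) :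
    ∑' j : ℤ, ((⨆ x ∈ dyadicLayer I v j, Gp x) * (dyad j)⁻¹) ^ Q ≤
      (2 ^ Q * geomConst Q) ^ 2 * ∫⁻ x in I, G x ^ Q ∂n := by
  set S : ℤ → ℝ≥0∞ := fun j => ⨆ x ∈ dyadicLayer I v j, Gp x
  have hlevel : ∀ k j, dyad k < S j →
      (dyad j)⁻¹ ^ Q ≤ 2 ^ Q * n (I ∩ {x | dyad k < G x}) := fun k j hkj => by
    obtain ⟨x, hx⟩ := lt_iSup_iff.1 hkj
    obtain ⟨⟨hxI, -, hxj⟩, hxk⟩ := lt_iSup_iff.1 hx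
    have h1 : (dyad j)⁻¹ ≤ 2 * (v x)⁻¹ := by
      rw [dyad_succ] at hxj
      calc (dyad j)⁻¹ = 2 * (2 * dyad j)⁻¹ := by
            rw [ENNReal.mul_inv (Or.inl two_ne_zero) (Or.inl ENNReal.ofNat_ne_top), ← mul_assoc,
              ENNReal.mul_inv_cancel two_ne_zero ENNReal.ofNat_ne_top, one_mul]
        _ ≤ 2 * (v x)⁻¹ := mul_le_mul' le_rfl (ENNReal.inv_le_inv.2 hxj.le)
    calc (dyad j)⁻¹ ^ Q ≤ (2 * (v x)⁻¹) ^ Q := ENNReal.rpow_le_rpow h1 hQ.le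
      _ = 2 ^ Q * (v x)⁻¹ ^ Q := ENNReal.mul_rpow_of_nonneg _ _ hQ.le
      _ ≤ 2 ^ Q * n (I ∩ {x | dyad k < G x}) := by
          refine mul_le_mul' le_rfl ((hn x hxI).trans (measure_mono fun y hy => ⟨hy.1, ?_⟩))
          exact hxk.trans_le (hGpG x y hy.2)
  calc ∑' j, (S j * (dyad j)⁻¹) ^ Q
      ≤ ∑' j, 2 ^ Q * ∑' k, {k | dyad k < S j}.indicator (fun k => dyad k ^ Q) k *
          (dyad j)⁻¹ ^ Q := by
        refine ENNReal.tsum_le_tsum fun j => ?_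
        rw [ENNReal.mul_rpow_of_nonneg _ _ hQ.le, ENNReal.tsum_mul_right, ← mul_assoc]
        exact mul_le_mul' (rpow_le_layerSum hQ (S j)) le_rfl
    _ = 2 ^ Q * ∑' k, dyad k ^ Q *
          ∑' j, {j | dyad k < S j}.indicator (fun j => (dyad j)⁻¹ ^ Q) j := by
        rw [ENNReal.tsum_mul_left, ENNReal.tsum_comm]
        congr 1
        refine tsum_congr fun k => ?_
        rw [← ENNReal.tsum_mul_left]
        refine tsum_congr fun j => ?_
        by_cases h : dyad k < S j <;> simp [indicator, h]
    _ ≤ 2 ^ Q * ∑' k, dyad k ^ Q *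
          (geomConst Q * (2 ^ Q * n (I ∩ {x | dyad k < G x}))) := by
        refine mul_le_mul' le_rfl (ENNReal.tsum_le_tsum fun k => mul_le_mul' le_rfl ?_)
        exact tsum_dyad_inv_le hQ fun j hj => hlevel k j hj
    _ = 2 ^ Q * (geomConst Q * 2 ^ Q) *
          ∑' k, dyad k ^ Q * n (I ∩ {x | dyad k < G x}) := by
        rw [mul_assoc, ← ENNReal.tsum_mul_left (a := geomConst Q * 2 ^ Q)]
        congr 1
        refine tsum_congr fun k => ?_
        ring
    _ ≤ 2 ^ Q * (geomConst Q * 2 ^ Q) * (geomConst Q * ∫⁻ x in I, G x ^ Q ∂n) :=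
        mul_le_mul' le_rfl (tsum_dyad_mul_measure_le n I hG hQ)
    _ = _ := by ring

theorem lintegral_le_tsum_dyadicLayer (m : Measure ℝ) {P : ℝ} (hP : 0 < P) {v : ℝ → ℝ≥0∞}
    (hI : MeasurableSet I) (hv : Monotone v) (hv0 : ∀ x ∈ I, v x ≠ 0)
    (hm : m (I ∩ {x | v x = ∞}) = 0) (f : ℝ → ℝ≥0∞) :
    ∫⁻ x in I, f x ^ P ∂m ≤
      ∑' j, (⨆ x ∈ dyadicLayer I v j, f x) ^ P * m (superlevel I v j) := by
  have hcov : I ⊆ (I ∩ {x | v x = ∞}) ∪ ⋃ j, dyadicLayer I v j := fun x hx => by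
    rcases eq_or_ne (v x) ∞ with ht | ht
    · exact Or.inl ⟨hx, ht⟩
    · obtain ⟨j, hj⟩ := exists_mem_Ico_dyad (hv0 x hx) ht
      exact Or.inr (mem_iUnion.2 ⟨j, hx, hj⟩)
  have hLm : ∀ j, MeasurableSet (dyadicLayer I v j) := fun j =>
    hI.inter ((measurableSet_le measurable_const hv.measurable).inter
      (measurableSet_lt hv.measurable measurable_const))
  calc ∫⁻ x in I, f x ^ P ∂m
      ≤ ∫⁻ x in (I ∩ {x | v x = ∞}) ∪ ⋃ j, dyadicLayer I v j, f x ^ P ∂m :=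
        lintegral_mono_set hcov
    _ ≤ (∫⁻ x in I ∩ {x | v x = ∞}, f x ^ P ∂m) +
          ∫⁻ x in ⋃ j, dyadicLayer I v j, f x ^ P ∂m := lintegral_union_le _ _ _
    _ ≤ 0 + ∑' j, ∫⁻ x in dyadicLayer I v j, f x ^ P ∂m :=
        add_le_add (setLIntegral_measure_zero _ _ hm).le (lintegral_iUnion_le _ _)
    _ ≤ _ := by
        rw [zero_add]
        refine ENNReal.tsum_le_tsum fun j => ?_
        calc ∫⁻ x in dyadicLayer I v j, f x ^ P ∂m
            ≤ ∫⁻ _ in dyadicLayer I v j, (⨆ x ∈ dyadicLayer I v j, f x) ^ P ∂m :=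
              setLIntegral_mono' (hLm j) fun x hx =>
                ENNReal.rpow_le_rpow (le_iSup₂_of_le x hx le_rfl) hP.le
          _ = (⨆ x ∈ dyadicLayer I v j, f x) ^ P * m (dyadicLayer I v j) := setLIntegral_const _ _
          _ ≤ _ := by
              have hsub : dyadicLayer I v j ⊆ superlevel I v j := fun x hx => ⟨hx.1, hx.2.1⟩
              exact mul_le_mul' le_rfl (measure_mono hsub)

theorem lpNorm_le_dyadicSum (hp : p ≠ 0) (hp' : p ≠ ∞) (hq : q ≠ 0) (hq' : q ≠ ∞)
    (hr : 0 < r) (hpqr : p.toReal / q.toReal + p.toReal / r = 1)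
    (hI : MeasurableSet I) (hu : Measurable u) (hw : Measurable w)
    (hut : ∀ t ∈ I, tailNorm q I ν u t < ∞)
    (hX : dyadicSum p r I (tailRecip q I ν u) μ w ≠ ∞) (g : ℝ → ℝ≥0∞) :
    lpNorm p I μ (fun x => g x * w x) ≤
      ((2 ^ q.toReal * geomConst q.toReal) ^ 2) ^ (1 / q.toReal) *
        dyadicSum p r I (tailRecip q I ν u) μ w ^ (1 / r) *
        lpNorm q I ν fun x => u x * lpNorm ∞ (I ∩ Iio x) μ g := by
  have hP := ENNReal.toReal_pos hp hp'
  have hQ := ENNReal.toReal_pos hq hq'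
  set P := p.toReal
  set Q := q.toReal
  set v := tailRecip q I ν u
  set X := dyadicSum p r I v μ w with hXdef
  set Gp : ℝ → ℝ≥0∞ := fun x => lpNorm ∞ (I ∩ Iic x) μ g
  set G : ℝ → ℝ≥0∞ := fun x => lpNorm ∞ (I ∩ Iio x) μ g
  set m := μ.withDensity fun x => w x ^ P with hmdef
  set n := ν.withDensity fun x => u x ^ Q with hndef
  have hGp : Measurable Gp := (runningSup_monotone g).measurable
  have hG : Measurable G := (openRunningSup_monotone g).measurable
  have hv : Monotone v := tailRecip_monotone
  have hR : (lpNorm q I ν fun x => u x * G x) ^ Q = ∫⁻ x in I, G x ^ Q ∂n := by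
    rw [hndef, ← lpNorm_mul_rpow hq hq' hI hu hG]
    simp only [mul_comm]
    rfl
  set R := lpNorm q I ν fun x => u x * G x
  have hsum : ∑' j, ((⨆ x ∈ dyadicLayer I v j, Gp x) * (dyad j)⁻¹) ^ Q ≤
      (2 ^ Q * geomConst Q) ^ 2 * R ^ Q := by
    rw [hR]
    refine tsum_iSup_dyadicLayer_le n hQ hG (fun x y hxy => ?_) fun x hx => ?_
    · exact lpNorm_mono_set (inter_subset_inter_right I (Iic_subset_Iio.2 hxy))
    · rw [hndef, withDensity_eq_lpNorm hq hq' (hI.inter measurableSet_Ioi)]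
      simp only [v, tailRecip, inv_inv, openTailNorm]
      exact le_rfl
  have hm : m (I ∩ {x | v x = ∞}) = 0 := by
    have hmeas : MeasurableSet (I ∩ {x | v x = ∞}) :=
      hI.inter (hv.measurable (measurableSet_singleton ∞))
    have h0 : lpNorm p (I ∩ {x | v x = ∞}) μ w = 0 :=
      eq_zero_of_dyadicSum_ne_top hr hX fun j => lpNorm_mono_set fun x hx =>
        ⟨hx.1, le_of_le_of_eq le_top (Eq.symm hx.2)⟩
    rw [hmdef, withDensity_eq_lpNorm hp hp' hmeas, h0, ENNReal.zero_rpow_of_pos hP]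
  rw [← ENNReal.rpow_le_rpow_iff hP]
  calc lpNorm p I μ (fun x => g x * w x) ^ P
      ≤ lpNorm p I μ (fun x => Gp x * w x) ^ P :=
        ENNReal.rpow_le_rpow (lpNorm_mul_le_runningSup hI g) hP.le
    _ ≤ ∑' j, (⨆ x ∈ dyadicLayer I v j, Gp x) ^ P * m (superlevel I v j) := by
        rw [lpNorm_mul_rpow hp hp' hI hw hGp]
        exact lintegral_le_tsum_dyadicLayer m hP hI hv (tailRecip_ne_zero hut) hm Gp
    _ = ∑' j, (((⨆ x ∈ dyadicLayer I v j, Gp x) * (dyad j)⁻¹) ^ Q) ^ (P / Q) *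
          ((dyad j * lpNorm p (superlevel I v j) μ w) ^ r) ^ (P / r) := by
        refine tsum_congr fun j => ?_
        rw [hmdef, withDensity_eq_lpNorm hp hp' (measurableSet_superlevel hI hv j),
          ← ENNReal.rpow_mul, ← ENNReal.rpow_mul, mul_div_cancel₀ P hQ.ne',
          mul_div_cancel₀ P hr.ne', ← ENNReal.mul_rpow_of_nonneg _ _ hP.le,
          ← ENNReal.mul_rpow_of_nonneg _ _ hP.le]
        congr 1
        rw [mul_assoc, ← mul_assoc (dyad j)⁻¹,
          ENNReal.inv_mul_cancel (dyad_ne_zero j) (dyad_ne_top j), one_mul]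
    _ ≤ (∑' j, ((⨆ x ∈ dyadicLayer I v j, Gp x) * (dyad j)⁻¹) ^ Q) ^ (P / Q) * X ^ (P / r) :=
        tsum_rpow_mul_rpow_le _ _ (by positivity) (by positivity) hpqr
    _ ≤ ((2 ^ Q * geomConst Q) ^ 2 * R ^ Q) ^ (P / Q) * X ^ (P / r) :=
        mul_le_mul' (ENNReal.rpow_le_rpow hsum (by positivity)) le_rfl
    _ = _ := by
        simp only [ENNReal.mul_rpow_of_nonneg _ _ hP.le]
        rw [ENNReal.mul_rpow_of_nonneg _ _ (by positivity), ← ENNReal.rpow_mul,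
          ← ENNReal.rpow_mul, ← ENNReal.rpow_mul, mul_div_cancel₀ P hQ.ne', one_div_mul_eq_div,
          one_div_mul_eq_div]
        ring

/-! ### Necessity for `p < q < ∞` -/

/-- The superlevel sets of `v` for the indices `a ≤ j ≤ b`, and empty sets for other indices. -/
def windowLevel (I : Set ℝ) (v : ℝ → ℝ≥0∞) (a b j : ℤ) : Set ℝ :=
  {x | j ∈ Icc a b ∧ x ∈ superlevel I v j}

theorem windowLevel_subset {v : ℝ → ℝ≥0∞} {a b : ℤ} (j : ℤ) :
    windowLevel I v a b j ⊆ superlevel I v j := fun _ hx => hx.2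

theorem windowLevel_eq {v : ℝ → ℝ≥0∞} {a b j : ℤ} (hj : j ∈ Icc a b) :
    windowLevel I v a b j = superlevel I v j := by
  ext x
  simp only [windowLevel, mem_ofPred_eq, hj, true_and]

theorem windowLevel_eq_empty {v : ℝ → ℝ≥0∞} {a b j : ℤ} (hj : j ∉ Icc a b) :
    windowLevel I v a b j = ∅ := by
  ext x
  simp only [windowLevel, mem_ofPred_eq, hj, false_and, mem_empty_iff_false]

theorem measurableSet_windowLevel {v : ℝ → ℝ≥0∞} (hI : MeasurableSet I) (hv : Monotone v)
    (a b j : ℤ) : MeasurableSet (windowLevel I v a b j) := by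
  by_cases hj : j ∈ Icc a b
  · rw [windowLevel_eq hj]
    exact measurableSet_superlevel hI hv j
  · rw [windowLevel_eq_empty hj]
    exact MeasurableSet.empty

theorem windowLevel_diff_disjoint {v : ℝ → ℝ≥0∞} {a b i j : ℤ} {x : ℝ}
    (hi : x ∈ windowLevel I v a b i \ windowLevel I v a b (i + 1))
    (hj : x ∈ windowLevel I v a b j \ windowLevel I v a b (j + 1)) : i = j := by
  have key : ∀ i j : ℤ, x ∈ windowLevel I v a b i \ windowLevel I v a b (i + 1) →
      x ∈ windowLevel I v a b j → j ≤ i := fun i j hi hj => by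
    by_contra! hij
    exact hi.2 ⟨⟨hi.1.1.1.trans (by omega), (Int.add_one_le_iff.2 hij).trans hj.1.2⟩,
      superlevel_anti (Int.add_one_le_iff.2 hij) hj.2⟩
  exact le_antisymm (key j i hj hi.1) (key i j hi hj.1)

/-- The weights `c_j` of the test function `g = ⨆_j c_j 1_{T_j}` satisfy
`c_j ^ q 2 ^ (-j q) = c_j ^ p W_j ^ p = (2 ^ j W_j) ^ r`. -/
noncomputable def testWeight (P Q r : ℝ) (W : ℤ → ℝ≥0∞) (j : ℤ) : ℝ≥0∞ :=
  dyad j ^ (r / P) * W j ^ (r / Q)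

theorem testWeight_rpow_right {P Q : ℝ} (hP : 0 < P) (hQ : 0 < Q) (hr : 0 < r)
    (hpqr : P / Q + P / r = 1) (W : ℤ → ℝ≥0∞) (j : ℤ) :
    testWeight P Q r W j ^ Q * (dyad j)⁻¹ ^ Q = (dyad j * W j) ^ r := by
  have h1 : r / P * Q = r + Q := by
    field_simp at hpqr ⊢
    linarith
  have h2 : dyad j ^ (r + Q) = dyad j ^ r * dyad j ^ Q :=
    ENNReal.rpow_add _ _ (dyad_ne_zero j) (dyad_ne_top j)
  rw [testWeight, ENNReal.mul_rpow_of_nonneg _ _ hQ.le, ← ENNReal.rpow_mul, ← ENNReal.rpow_mul,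
    h1, h2, div_mul_cancel₀ r hQ.ne', ENNReal.inv_rpow, ENNReal.mul_rpow_of_nonneg _ _ hr.le]
  calc dyad j ^ r * dyad j ^ Q * W j ^ r * (dyad j ^ Q)⁻¹
      = dyad j ^ r * W j ^ r * (dyad j ^ Q * (dyad j ^ Q)⁻¹) := by ring
    _ = dyad j ^ r * W j ^ r := by
        rw [ENNReal.mul_inv_cancel (dyad_rpow_ne_zero _ _) (dyad_rpow_ne_top _ _), mul_one]

theorem testWeight_rpow_left {P Q : ℝ} (hP : 0 < P) (hQ : 0 < Q) (hr : 0 < r)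
    (hpqr : P / Q + P / r = 1) (W : ℤ → ℝ≥0∞) (j : ℤ) (y : ℝ≥0∞) :
    testWeight P Q r W j ^ P * y ^ P =
      ((dyad j * W j) ^ r) ^ (P / Q) * ((dyad j * y) ^ r) ^ (P / r) := by
  have h1 : r = r * (P / Q) + P := by
    field_simp at hpqr ⊢
    linarith
  have h2 : dyad j ^ r = dyad j ^ (r * (P / Q)) * dyad j ^ P := by
    conv_lhs => rw [h1, ENNReal.rpow_add _ _ (dyad_ne_zero j) (dyad_ne_top j)]
  rw [testWeight, ENNReal.mul_rpow_of_nonneg _ _ hP.le, ← ENNReal.rpow_mul, ← ENNReal.rpow_mul,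
    div_mul_cancel₀ r hP.ne', h2, ← ENNReal.rpow_mul, ← ENNReal.rpow_mul, mul_div_cancel₀ P hr.ne',
    ENNReal.mul_rpow_of_nonneg _ _ (by positivity), ENNReal.mul_rpow_of_nonneg _ _ hP.le,
    show r / Q * P = r * (P / Q) by ring]
  ring

/-- Hölder's inequality and a shift of the index show that the part of the test sum that is
carried by `T_{j+1}` is smaller than the whole sum by the factor `2 ^ (-P)`. -/
theorem tsum_testWeight_shift_le {P Q : ℝ} (hP : 0 < P) (hQ : 0 < Q) (hr : 0 < r)
    (hpqr : P / Q + P / r = 1) (W : ℤ → ℝ≥0∞) :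
    ∑' j, testWeight P Q r W j ^ P * W (j + 1) ^ P ≤ 2 ^ (-P) * ∑' j, (dyad j * W j) ^ r := by
  have hshift : ∑' j, (dyad j * W (j + 1)) ^ r = 2 ^ (-r) * ∑' j, (dyad j * W j) ^ r := by
    rw [← ENNReal.tsum_mul_left, ← (Equiv.addRight (1 : ℤ)).tsum_eq
      (fun j => (2 : ℝ≥0∞) ^ (-r) * (dyad j * W j) ^ r)]
    refine tsum_congr fun j => ?_
    rw [Equiv.coe_addRight, dyad_succ, mul_assoc, ENNReal.mul_rpow_of_nonneg 2 _ hr.le,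
      ← mul_assoc, ← ENNReal.rpow_add _ _ two_ne_zero ENNReal.ofNat_ne_top, neg_add_cancel,
      ENNReal.rpow_zero, one_mul]
  simp only [testWeight_rpow_left hP hQ hr hpqr]
  refine (tsum_rpow_mul_rpow_le (fun j => (dyad j * W j) ^ r) (fun j => (dyad j * W (j + 1)) ^ r)
    (by positivity) (by positivity) hpqr).trans (le_of_eq ?_)
  set S := ∑' j, (dyad j * W j) ^ r
  rw [hshift, ENNReal.mul_rpow_of_nonneg _ _ (by positivity), ← ENNReal.rpow_mul,
    show -r * (P / r) = -P by field_simp, mul_left_comm,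
    ← ENNReal.rpow_add_of_nonneg _ _ (by positivity) (by positivity), hpqr, ENNReal.rpow_one]

/-- The constant in the necessity estimate, from the factor `1 - 2 ^ (-P)`. -/
noncomputable def windowConst (P r : ℝ) : ℝ≥0∞ := (1 - 2 ^ (-P))⁻¹ ^ (r / P)

theorem windowConst_ne_top {P : ℝ} (hP : 0 < P) (hr : 0 < r) : windowConst P r ≠ ∞ :=
  ENNReal.rpow_ne_top_of_nonneg (by positivity)
    (ENNReal.inv_ne_top.2 (tsub_pos_of_lt (two_rpow_neg_lt_one hP)).ne')

theorem le_windowConst_mul {P Q : ℝ} (hP : 0 < P) (hQ : 0 < Q) (hr : 0 < r)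
    (hpqr : P / Q + P / r = 1) {S c : ℝ≥0∞} (hS : S ≠ ∞)
    (h : S ≤ (c * S ^ (1 / Q)) ^ P + 2 ^ (-P) * S) : S ≤ windowConst P r * c ^ r := by
  rcases eq_or_ne S 0 with rfl | hS0
  · exact zero_le
  have hθ := two_rpow_neg_lt_one hP
  have hθ0 : (1 - 2 ^ (-P) : ℝ≥0∞) ≠ 0 := (tsub_pos_of_lt hθ).ne'
  have hθt : (1 - 2 ^ (-P) : ℝ≥0∞) ≠ ∞ := ne_top_of_le_ne_top ENNReal.one_ne_top tsub_le_self
  have hsplit : S = S ^ (P / r) * S ^ (P / Q) := by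
    rw [← ENNReal.rpow_add_of_nonneg _ _ (by positivity) (by positivity), add_comm, hpqr,
      ENNReal.rpow_one]
  have h1 : (1 - 2 ^ (-P)) * S ≤ c ^ P * S ^ (P / Q) := by
    rw [ENNReal.sub_mul fun _ _ => hS, one_mul, tsub_le_iff_right]
    refine h.trans (le_of_eq ?_)
    rw [ENNReal.mul_rpow_of_nonneg _ _ hP.le, ← ENNReal.rpow_mul, one_div_mul_eq_div]
  have hpos : S ^ (P / Q) ≠ 0 := by simp [ENNReal.rpow_eq_zero_iff, hS0, hS]
  have htop : S ^ (P / Q) ≠ ∞ := ENNReal.rpow_ne_top_of_nonneg (by positivity) hS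
  have h2 : (1 - 2 ^ (-P)) * S ^ (P / r) ≤ c ^ P := by
    rw [← ENNReal.mul_le_mul_iff_left hpos htop]
    rwa [mul_assoc, ← hsplit]
  have h3 : S ^ (P / r) ≤ (1 - 2 ^ (-P))⁻¹ * c ^ P := by
    rw [mul_comm _ (c ^ P), ← div_eq_mul_inv, ENNReal.le_div_iff_mul_le (Or.inl hθ0) (Or.inl hθt),
      mul_comm]
    exact h2
  have h4 := ENNReal.rpow_le_rpow h3 (z := r / P) (by positivity)
  rwa [← ENNReal.rpow_mul, div_mul_div_cancel₀ hr.ne', div_self hP.ne', ENNReal.rpow_one,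
    ENNReal.mul_rpow_of_nonneg _ _ (by positivity), ← ENNReal.rpow_mul, mul_div_cancel₀ r hP.ne']
    at h4

/-- The left-hand side of the inequality for the test function `g = ⨆_j c_j 1_{T_j}`. -/
theorem tsum_le_lintegral_iSup_indicator (m : Measure ℝ) {P : ℝ} (hP : 0 < P) {v : ℝ → ℝ≥0∞}
    (hI : MeasurableSet I) (hv : Monotone v) (a b : ℤ) (c : ℤ → ℝ≥0∞) :
    ∑' j, c j ^ P * m (windowLevel I v a b j \ windowLevel I v a b (j + 1)) ≤
      ∫⁻ x in I, (⨆ j, (windowLevel I v a b j).indicator (fun _ => c j) x) ^ P ∂m := by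
  set D : ℤ → Set ℝ := fun j => windowLevel I v a b j \ windowLevel I v a b (j + 1)
  have hDm : ∀ j, MeasurableSet (D j) := fun j =>
    (measurableSet_windowLevel hI hv a b j).diff (measurableSet_windowLevel hI hv a b (j + 1))
  have hDI : ∀ j, D j ⊆ I := fun j x hx => hx.1.2.1
  have hint : ∀ j, c j ^ P * m (D j) = ∫⁻ x in I, (D j).indicator (fun _ => c j ^ P) x ∂m :=
    fun j => by
      rw [lintegral_indicator_const (hDm j), Measure.restrict_apply (hDm j),
        inter_eq_left.2 (hDI j)]
  rw [tsum_congr hint, ← lintegral_tsum fun j => (measurable_const.indicator (hDm j)).aemeasurable]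
  refine lintegral_mono fun x => ?_
  by_cases hx : ∃ j, x ∈ D j
  · obtain ⟨j, hj⟩ := hx
    rw [tsum_eq_single j fun i hi => indicator_of_notMem
      (fun hi' => hi (windowLevel_diff_disjoint hi' hj)) _, indicator_of_mem hj]
    refine ENNReal.rpow_le_rpow (le_iSup_of_le j ?_) hP.le
    rw [indicator_of_mem hj.1]
  · push Not at hx
    simp [hx]

/-- The right-hand side of the inequality for the test function `g = ⨆_j c_j 1_{T_j}`. -/
theorem lpNorm_iSup_indicator_le (hq : q ≠ 0) (hq' : q ≠ ∞) (hI : MeasurableSet I)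
    (hu : Measurable u) (a b : ℤ) (c : ℤ → ℝ≥0∞) :
    lpNorm q I ν (fun x => u x * lpNorm ∞ (I ∩ Iio x) μ fun y =>
        ⨆ j, (windowLevel I (tailRecip q I ν u) a b j).indicator (fun _ => c j) y) ≤
      (∑' j, c j ^ q.toReal * (dyad j)⁻¹ ^ q.toReal) ^ (1 / q.toReal) := by
  have hQ := ENNReal.toReal_pos hq hq'
  set Q := q.toReal
  set v := tailRecip q I ν u
  set T : ℤ → Set ℝ := windowLevel I v a b
  set T' : ℤ → Set ℝ := fun j => I ∩ ⋃ y ∈ T j, Ioi y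
  have hT'm : ∀ j, MeasurableSet (T' j) := fun j =>
    hI.inter (isOpen_biUnion fun _ _ => isOpen_Ioi).measurableSet
  have hT'norm : ∀ j, lpNorm q (T' j) ν u ≤ (dyad j)⁻¹ := fun j => by
    refine lpNorm_le_of_forall_inter_Ici_le hq (hT'm j) hu fun x hx => ?_
    obtain ⟨y, hy, hyx⟩ := mem_iUnion₂.1 hx.2
    have h1 : lpNorm q (T' j ∩ Ici x) ν u ≤ openTailNorm q I ν u y :=
      lpNorm_mono_set fun z hz => ⟨hz.1.1, (mem_Ioi.1 hyx).trans_le hz.2⟩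
    exact h1.trans (ENNReal.le_inv_iff_le_inv.1 hy.2.2)
  have hG : ∀ x ∈ I, (lpNorm ∞ (I ∩ Iio x) μ fun y => ⨆ j, (T j).indicator (fun _ => c j) y) ≤
      (∑' j, (T' j).indicator (fun _ => c j ^ Q) x) ^ (1 / Q) := fun x hx => by
    refine lpNorm_top_le_iff.2 (ae_restrict_of_forall_mem (hI.inter measurableSet_Iio)
      fun y hy => iSup_le fun j => indicator_apply_le' (fun hyj => ?_) fun _ => zero_le)
    have hxj : x ∈ T' j := ⟨hx, mem_iUnion₂.2 ⟨y, hyj, hy.2⟩⟩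
    rw [one_div, ENNReal.le_rpow_inv_iff hQ]
    refine le_trans ?_ (ENNReal.le_tsum j)
    rw [indicator_of_mem hxj]
  have hTm : ∀ j, Measurable ((T' j).indicator fun _ => c j ^ Q) := fun j =>
    measurable_const.indicator (hT'm j)
  rw [one_div, ENNReal.le_rpow_inv_iff hQ]
  calc _ ≤ lpNorm q I ν (fun x =>
          (∑' j, (T' j).indicator (fun _ => c j ^ Q) x) ^ (1 / Q) * u x) ^ Q := by
        refine ENNReal.rpow_le_rpow (lpNorm_mono hI fun x hx => ?_) hQ.le
        rw [mul_comm]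
        exact mul_le_mul' (hG x hx) le_rfl
    _ = ∫⁻ x in I, ∑' j, (T' j).indicator (fun _ => c j ^ Q) x
          ∂ν.withDensity fun x => u x ^ Q := by
        rw [lpNorm_mul_rpow hq hq' hI hu ((Measurable.tsum hTm).pow_const _)]
        refine lintegral_congr fun x => ?_
        rw [← ENNReal.rpow_mul, one_div_mul_cancel hQ.ne', ENNReal.rpow_one]
    _ = ∑' j, c j ^ Q * lpNorm q (T' j) ν u ^ Q := by
        rw [lintegral_tsum fun j => (hTm j).aemeasurable]
        refine tsum_congr fun j => ?_
        rw [lintegral_indicator_const (hT'm j), Measure.restrict_apply (hT'm j),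
          inter_eq_left.2 inter_subset_left, withDensity_eq_lpNorm hq hq' (hT'm j)]
    _ ≤ ∑' j, c j ^ Q * (dyad j)⁻¹ ^ Q := ENNReal.tsum_le_tsum fun j =>
        mul_le_mul' le_rfl (ENNReal.rpow_le_rpow (hT'norm j) hQ.le)

theorem tsum_windowLevel_le (hp : p ≠ 0) (hp' : p ≠ ∞) (hq : q ≠ 0) (hq' : q ≠ ∞)
    (hr : 0 < r) (hpqr : p.toReal / q.toReal + p.toReal / r = 1)
    (hI : MeasurableSet I) (hu : Measurable u) (hw : Measurable w) {c : ℝ≥0}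
    (hc : InequalityHolds p q I μ ν u w c) (a b : ℤ) :
    ∑' j, (dyad j * lpNorm p (windowLevel I (tailRecip q I ν u) a b j) μ w) ^ r ≤
      windowConst p.toReal r * (c : ℝ≥0∞) ^ r := by
  have hP := ENNReal.toReal_pos hp hp'
  have hQ := ENNReal.toReal_pos hq hq'
  set P := p.toReal
  set Q := q.toReal
  set v := tailRecip q I ν u
  have hv : Monotone v := tailRecip_monotone
  set T : ℤ → Set ℝ := windowLevel I v a b
  have hTm : ∀ j, MeasurableSet (T j) := measurableSet_windowLevel hI hv a b
  set W : ℤ → ℝ≥0∞ := fun j => lpNorm p (T j) μ w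
  set S := ∑' j, (dyad j * W j) ^ r with hSdef
  set m := μ.withDensity fun x => w x ^ P with hmdef
  set g : ℝ → ℝ≥0∞ := fun x => ⨆ j, (T j).indicator (fun _ => testWeight P Q r W j) x
  have hg : Measurable g := Measurable.iSup fun j => measurable_const.indicator (hTm j)
  -- The window makes the test sum finite, so that its small part can be absorbed.
  have hWt : ∀ j, W j ≠ ∞ := fun j => by
    refine ne_top_of_le_ne_top ?_ ((lpNorm_mono_set (windowLevel_subset j)).trans
      (lpNorm_superlevel_le hp hI hw (fun x _ => hc.tailNorm_le hI x) j))
    exact ENNReal.mul_ne_top ENNReal.coe_ne_top (ENNReal.inv_ne_top.2 (dyad_ne_zero j))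
  have hW0 : ∀ j, j ∉ Finset.Icc a b → (dyad j * W j) ^ r = 0 := fun j hj => by
    have : T j = ∅ := windowLevel_eq_empty (by simpa using hj)
    simp [W, this, lpNorm, ENNReal.zero_rpow_of_pos hr]
  have hSt : S ≠ ∞ := by
    rw [hSdef, tsum_eq_sum hW0]
    refine ENNReal.sum_ne_top.2 fun j _ => ENNReal.rpow_ne_top_of_nonneg hr.le
      (ENNReal.mul_ne_top (dyad_ne_top j) (hWt j))
  have hWm : ∀ j, W j ^ P = m (T j) := fun j => (withDensity_eq_lpNorm hp hp' (hTm j)).symm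
  have hS : S = ∑' j, testWeight P Q r W j ^ P * W j ^ P := by
    refine tsum_congr fun j => ?_
    rw [testWeight_rpow_left hP hQ hr hpqr, ← ENNReal.rpow_add_of_nonneg _ _ (by positivity)
      (by positivity), hpqr, ENNReal.rpow_one]
  refine le_windowConst_mul hP hQ hr hpqr hSt ?_
  calc S ≤ ∑' j, (testWeight P Q r W j ^ P * m (T j \ T (j + 1)) +
          testWeight P Q r W j ^ P * W (j + 1) ^ P) := by
        rw [hS]
        refine ENNReal.tsum_le_tsum fun j => ?_
        rw [hWm, hWm, ← mul_add]
        refine mul_le_mul' le_rfl ((measure_mono ?_).trans (measure_union_le _ _))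
        rw [sdiff_union_self]
        exact subset_union_left
    _ = ∑' j, testWeight P Q r W j ^ P * m (T j \ T (j + 1)) +
          ∑' j, testWeight P Q r W j ^ P * W (j + 1) ^ P := ENNReal.tsum_add
    _ ≤ (c * S ^ (1 / Q)) ^ P + 2 ^ (-P) * S := by
        refine add_le_add ?_ (tsum_testWeight_shift_le hP hQ hr hpqr W)
        refine (tsum_le_lintegral_iSup_indicator m hP hI hv a b _).trans ?_
        rw [hmdef, ← lpNorm_mul_rpow hp hp' hI hw hg]
        refine ENNReal.rpow_le_rpow ((hc g hg).trans (mul_le_mul' le_rfl ?_)) hP.le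
        refine (lpNorm_iSup_indicator_le hq hq' hI hu a b _).trans (le_of_eq ?_)
        congr 1
        exact tsum_congr fun j => testWeight_rpow_right hP hQ hr hpqr W j

theorem dyadicSum_le_of_inequality (hp : p ≠ 0) (hp' : p ≠ ∞) (hq : q ≠ 0) (hq' : q ≠ ∞)
    (hr : 0 < r) (hpqr : p.toReal / q.toReal + p.toReal / r = 1)
    (hI : MeasurableSet I) (hu : Measurable u) (hw : Measurable w) {c : ℝ≥0}
    (hc : InequalityHolds p q I μ ν u w c) :
    dyadicSum p r I (tailRecip q I ν u) μ w ≤ windowConst p.toReal r * (c : ℝ≥0∞) ^ r := by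
  rw [dyadicSum, ENNReal.tsum_eq_iSup_sum]
  refine iSup_le fun S => ?_
  obtain ⟨a, ha⟩ := S.bddBelow
  obtain ⟨b, hb⟩ := S.bddAbove
  refine le_trans ?_ (tsum_windowLevel_le hp hp' hq hq' hr hpqr hI hu hw hc a b)
  refine le_trans (Finset.sum_le_sum fun j hj => ?_) (ENNReal.sum_le_tsum S)
  rw [windowLevel_eq ⟨ha hj, hb hj⟩]

end

/-! ### The characterizations -/

section

variable {a b : EReal}

theorem ordConnected_interval : (interval a b).OrdConnected :=
  ⟨fun _ hx _ hy _ hz => ⟨hx.1.trans_le (EReal.coe_le_coe_iff.2 hz.1),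
    (EReal.coe_le_coe_iff.2 hz.2).trans_lt hy.2⟩⟩

theorem exists_lt_mem_interval : ∀ x ∈ interval a b, ∃ y ∈ interval a b, y < x := fun x hx => by
  obtain ⟨y, hy, hyx⟩ := EReal.lt_iff_exists_real_btwn.1 hx.1
  exact ⟨y, ⟨hy, hyx.trans hx.2⟩, EReal.coe_lt_coe_iff.1 hyx⟩

end

section

variable {p q : ℝ≥0∞} {r : ℝ} {I : Set ℝ} {μ ν : Measure ℝ} {u w : ℝ → ℝ≥0∞}

/-- The constant in the sufficiency estimate for `p < q < ∞`, in terms of the dyadic sum. -/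
noncomputable def layerConst (Q : ℝ) : ℝ≥0∞ := ((2 ^ Q * geomConst Q) ^ 2) ^ (1 / Q)

theorem layerConst_ne_top {Q : ℝ} (hQ : 0 < Q) : layerConst Q ≠ ∞ :=
  ENNReal.rpow_ne_top_of_nonneg (by positivity)
    (ENNReal.pow_ne_top (ENNReal.mul_ne_top (two_rpow_ne_top Q) (geomConst_ne_top hQ)))

theorem B₂_le_dyadicSum (hr : 0 < r) (hq : q ≠ 0) (hI : I.OrdConnected) (hu : Measurable u)
    (hut : ∀ t ∈ I, tailNorm q I ν u t < ∞) :
    B₂ p q r hr.le I μ ν u w ≤ 4 * dyadicSum p r I (tailRecip q I ν u) μ w ^ (1 / r) :=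
  stieltjes_add_le_dyadicSum hr hI hut _
    (isRightRegularization_tailNorm hq hr hI.measurableSet hu)

theorem dyadicSum_le_B₂ (hp : p ≠ 0) (hq : q ≠ 0) (hr : 0 < r) (hI : I.OrdConnected)
    (hmin : ∀ x ∈ I, ∃ y ∈ I, y < x) (hu : Measurable u) (hw : Measurable w) :
    dyadicSum p r I (tailRecip q I ν u) μ w ^ (1 / r) ≤
      stieltjesConst r * B₂ p q r hr.le I μ ν u w :=
  dyadicSum_le_stieltjes_add hp hq hr hI hmin hu hw _
    (isRightRegularization_tailNorm hq hr hI.measurableSet hu)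

theorem inequality_of_B₂ (hp : p ≠ 0) (hp' : p ≠ ∞) (hq : q ≠ 0) (hq' : q ≠ ∞)
    (hr : 0 < r) (hpqr : p.toReal / q.toReal + p.toReal / r = 1) (hI : I.OrdConnected)
    (hmin : ∀ x ∈ I, ∃ y ∈ I, y < x) (hu : Measurable u) (hw : Measurable w)
    (hut : ∀ t ∈ I, tailNorm q I ν u t < ∞) (hB : B₂ p q r hr.le I μ ν u w < ∞) {c : ℝ≥0}
    (hc : layerConst q.toReal * stieltjesConst r * B₂ p q r hr.le I μ ν u w ≤ c) :
    InequalityHolds p q I μ ν u w c := fun g _ => by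
  have h1 := dyadicSum_le_B₂ (μ := μ) (ν := ν) hp hq hr hI hmin hu hw
  have hX : dyadicSum p r I (tailRecip q I ν u) μ w ≠ ∞ := fun hX => by
    rw [hX, ENNReal.top_rpow_of_pos (by positivity)] at h1
    exact (ENNReal.mul_lt_top (stieltjesConst_ne_top hr).lt_top hB).ne (top_unique h1)
  refine (lpNorm_le_dyadicSum hp hp' hq hq' hr hpqr hI.measurableSet hu hw hut hX g).trans
    (mul_le_mul' (le_trans ?_ hc) le_rfl)
  rw [mul_assoc]
  exact mul_le_mul' le_rfl h1

theorem B₂_le (hp : p ≠ 0) (hp' : p ≠ ∞) (hq : q ≠ 0) (hq' : q ≠ ∞)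
    (hr : 0 < r) (hpqr : p.toReal / q.toReal + p.toReal / r = 1) (hI : I.OrdConnected)
    (hu : Measurable u) (hw : Measurable w) (hut : ∀ t ∈ I, tailNorm q I ν u t < ∞) {c : ℝ≥0}
    (hc : InequalityHolds p q I μ ν u w c) :
    B₂ p q r hr.le I μ ν u w ≤ 4 * windowConst p.toReal r ^ (1 / r) * c := by
  refine (B₂_le_dyadicSum hr hq hI hu hut).trans ?_
  rw [mul_assoc]
  refine mul_le_mul' le_rfl ?_
  refine (ENNReal.rpow_le_rpow (dyadicSum_le_of_inequality hp hp' hq hq' hr hpqr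
    hI.measurableSet hu hw hc) (by positivity)).trans (le_of_eq ?_)
  rw [ENNReal.mul_rpow_of_nonneg _ _ (by positivity), ← ENNReal.rpow_mul (c : ℝ≥0∞),
    mul_one_div_cancel hr.ne', ENNReal.rpow_one]

theorem B₃Stieltjes_le (hp : p ≠ 0) (hp' : p ≠ ∞) (hI : I.OrdConnected) (hu : Measurable u)
    (hw : Measurable w) (hut : ∀ t ∈ I, tailNorm ∞ I ν u t < ∞) :
    B₃Stieltjes p I μ ν u w ≤
      4 * (2 * geomConst p.toReal ^ (1 / p.toReal)) * B₃ p I μ ν u w := by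
  have hP := ENNReal.toReal_pos hp hp'
  refine (stieltjes_add_le_dyadicSum hP hI hut _
    (isRightRegularization_leftLim ENNReal.top_ne_zero hP hI.measurableSet hu)).trans ?_
  rw [mul_assoc]
  exact mul_le_mul' le_rfl (dyadicSum_le_B₃ hp hp' hI.measurableSet hw)

theorem B₃_le_B₃Stieltjes (hp : p ≠ 0) (hp' : p ≠ ∞) (hI : I.OrdConnected)
    (hmin : ∀ x ∈ I, ∃ y ∈ I, y < x) (hu : Measurable u) (hw : Measurable w) :
    B₃ p I μ ν u w ≤ 2 * stieltjesConst p.toReal * B₃Stieltjes p I μ ν u w := by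
  have hP := ENNReal.toReal_pos hp hp'
  refine (B₃_le_dyadicSum hp hp' hI.measurableSet hw).trans ?_
  rw [mul_assoc]
  exact mul_le_mul' le_rfl (dyadicSum_le_stieltjes_add hp ENNReal.top_ne_zero hP hI hmin hu hw _
    (isRightRegularization_leftLim ENNReal.top_ne_zero hP hI.measurableSet hu))

theorem exists_nnreal_bound {x y z : ℝ≥0∞} (hx : x ≠ ∞) (hy : y ≠ ∞) (hz : z ≠ ∞) :
    ∃ K : ℝ≥0, 0 < K ∧ x ≤ K ∧ y ≤ K ∧ z ≤ K := by
  lift x to ℝ≥0 using hx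
  lift y to ℝ≥0 using hy
  lift z to ℝ≥0 using hz
  refine ⟨x + y + z + 1, by positivity, ?_, ?_, ?_⟩ <;> norm_cast
  · exact le_add_right (le_add_right le_self_add)
  · exact le_add_right (le_add_right le_add_self)
  · exact le_add_right le_add_self

end

end ReverseHardy

theorem theorem4p1 (p q : ℝ≥0∞) (hp : 0 < p) (hq : 0 < q) :
    (q ≤ p → ∃ K : ℝ≥0, 0 < K ∧
      ∀ (a b : EReal), a < b → ∀ (μ ν : Measure ℝ) (u w : ℝ → ℝ≥0∞),
        Measurable u → Measurable w →
        (∀ t ∈ ReverseHardy.interval a b,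
          ReverseHardy.tailNorm q (ReverseHardy.interval a b) ν u t < ∞) →
        ((∃ c : ℝ≥0, 0 < c ∧
            ReverseHardy.InequalityHolds p q (ReverseHardy.interval a b) μ ν u w c) ↔
          ReverseHardy.B₁ p q (ReverseHardy.interval a b) μ ν u w < ∞) ∧
        ReverseHardy.bestConstant p q (ReverseHardy.interval a b) μ ν u w ≤
          K * ReverseHardy.B₁ p q (ReverseHardy.interval a b) μ ν u w ∧
        ReverseHardy.B₁ p q (ReverseHardy.interval a b) μ ν u w ≤
          K * ReverseHardy.bestConstant p q (ReverseHardy.interval a b) μ ν u w) ∧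
    (p < q → q < ∞ → ∀ (r : ℝ) (hr : 0 ≤ r), 1 / r = 1 / p.toReal - 1 / q.toReal →
      ∃ K : ℝ≥0, 0 < K ∧
      ∀ (a b : EReal), a < b → ∀ (μ ν : Measure ℝ) (u w : ℝ → ℝ≥0∞),
        Measurable u → Measurable w →
        (∀ t ∈ ReverseHardy.interval a b,
          ReverseHardy.tailNorm q (ReverseHardy.interval a b) ν u t < ∞) →
        ((∃ c : ℝ≥0, 0 < c ∧
            ReverseHardy.InequalityHolds p q (ReverseHardy.interval a b) μ ν u w c) ↔
          ReverseHardy.B₂ p q r hr (ReverseHardy.interval a b) μ ν u w < ∞) ∧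
        ReverseHardy.bestConstant p q (ReverseHardy.interval a b) μ ν u w ≤
          K * ReverseHardy.B₂ p q r hr (ReverseHardy.interval a b) μ ν u w ∧
        ReverseHardy.B₂ p q r hr (ReverseHardy.interval a b) μ ν u w ≤
          K * ReverseHardy.bestConstant p q (ReverseHardy.interval a b) μ ν u w) ∧
    (p < ∞ → q = ∞ → ∃ K : ℝ≥0, 0 < K ∧
      ∀ (a b : EReal), a < b → ∀ (μ ν : Measure ℝ) (u w : ℝ → ℝ≥0∞),
        Measurable u → Measurable w →
        (∀ t ∈ ReverseHardy.interval a b,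
          ReverseHardy.tailNorm q (ReverseHardy.interval a b) ν u t < ∞) →
        ((∃ c : ℝ≥0, 0 < c ∧
            ReverseHardy.InequalityHolds p q (ReverseHardy.interval a b) μ ν u w c) ↔
          ReverseHardy.B₃ p (ReverseHardy.interval a b) μ ν u w < ∞) ∧
        ReverseHardy.bestConstant p q (ReverseHardy.interval a b) μ ν u w ≤
          K * ReverseHardy.B₃ p (ReverseHardy.interval a b) μ ν u w ∧
        ReverseHardy.B₃ p (ReverseHardy.interval a b) μ ν u w ≤
          K * ReverseHardy.bestConstant p q (ReverseHardy.interval a b) μ ν u w ∧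
        ReverseHardy.B₃Stieltjes p (ReverseHardy.interval a b) μ ν u w ≤
          K * ReverseHardy.B₃ p (ReverseHardy.interval a b) μ ν u w ∧
        ReverseHardy.B₃ p (ReverseHardy.interval a b) μ ν u w ≤
          K * ReverseHardy.B₃Stieltjes p (ReverseHardy.interval a b) μ ν u w) := by
  have hp0 := hp.ne'
  have hq0 := hq.ne'
  refine ⟨fun hqp => ?_, fun hpq hqt r hr hpqr => ?_, fun hpt hqt => ?_⟩
  · -- For `q = ∞` the exponent `1 / q.toReal` is `1 / 0 = 0` and the power is `1`.
    have hconst : ReverseHardy.geomConst q.toReal ^ (1 / q.toReal) ≠ ∞ := by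
      rcases eq_or_ne q ∞ with rfl | hq'
      · simp
      · exact ENNReal.rpow_ne_top_of_nonneg (by positivity)
          (ReverseHardy.geomConst_ne_top (ENNReal.toReal_pos hq0 hq'))
    obtain ⟨K, hK, hK1, hK2, -⟩ := ReverseHardy.exists_nnreal_bound
      (x := 1 + 2 * ReverseHardy.geomConst q.toReal ^ (1 / q.toReal)) (y := 1) (z := 1)
      (ENNReal.add_ne_top.2 ⟨ENNReal.one_ne_top, ENNReal.mul_ne_top ENNReal.ofNat_ne_top hconst⟩)
      ENNReal.one_ne_top ENNReal.one_ne_top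
    refine ⟨K, hK, fun a b _ μ ν u w hu hw hut => ?_⟩
    have hI := (ReverseHardy.ordConnected_interval (a := a) (b := b)).measurableSet
    refine ReverseHardy.bestConstant_equiv hK1 hK2 hK (fun hB c hc => ?_) fun c hc => ?_
    · exact ReverseHardy.inequality_of_B₁ hp0 hq0 hqp hI hu hw hut hB hc
    · rw [one_mul]
      exact ReverseHardy.B₁_le hI hc
  · have hp' : p ≠ ∞ := (hpq.trans hqt).ne
    have hP := ENNReal.toReal_pos hp0 hp'
    have hQ := ENNReal.toReal_pos hq0 hqt.ne
    have hPQ : p.toReal < q.toReal := (ENNReal.toReal_lt_toReal hp' hqt.ne).2 hpq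
    have hr0 : 0 < r := by
      rw [← one_div_pos, hpqr, sub_pos]
      exact one_div_lt_one_div_of_lt hP hPQ
    have hpqr' : p.toReal / q.toReal + p.toReal / r = 1 := by
      rw [div_eq_mul_one_div p.toReal r, hpqr, mul_sub, mul_one_div_cancel hP.ne',
        ← div_eq_mul_one_div]
      ring
    obtain ⟨K, hK, hK1, hK2, -⟩ := ReverseHardy.exists_nnreal_bound
      (x := ReverseHardy.layerConst q.toReal * ReverseHardy.stieltjesConst r)
      (y := 4 * ReverseHardy.windowConst p.toReal r ^ (1 / r)) (z := 1)
      (ENNReal.mul_ne_top (ReverseHardy.layerConst_ne_top hQ)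
        (ReverseHardy.stieltjesConst_ne_top hr0))
      (ENNReal.mul_ne_top ENNReal.ofNat_ne_top (ENNReal.rpow_ne_top_of_nonneg (by positivity)
        (ReverseHardy.windowConst_ne_top hP hr0))) ENNReal.one_ne_top
    refine ⟨K, hK, fun a b _ μ ν u w hu hw hut => ?_⟩
    have hI := ReverseHardy.ordConnected_interval (a := a) (b := b)
    refine ReverseHardy.bestConstant_equiv hK1 hK2 hK (fun hB c hc => ?_) fun c hc => ?_
    · exact ReverseHardy.inequality_of_B₂ hp0 hp' hq0 hqt.ne hr0 hpqr' hI
        ReverseHardy.exists_lt_mem_interval hu hw hut hB hc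
    · exact ReverseHardy.B₂_le hp0 hp' hq0 hqt.ne hr0 hpqr' hI hu hw hut hc
  · subst hqt
    have hP := ENNReal.toReal_pos hp0 hpt.ne
    obtain ⟨K, hK, hK1, hK2, hK3⟩ := ReverseHardy.exists_nnreal_bound (x := 1)
      (y := 4 * (2 * ReverseHardy.geomConst p.toReal ^ (1 / p.toReal)))
      (z := 2 * ReverseHardy.stieltjesConst p.toReal) ENNReal.one_ne_top
      (ENNReal.mul_ne_top ENNReal.ofNat_ne_top (ENNReal.mul_ne_top ENNReal.ofNat_ne_top
        (ENNReal.rpow_ne_top_of_nonneg (by positivity) (ReverseHardy.geomConst_ne_top hP))))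
      (ENNReal.mul_ne_top ENNReal.ofNat_ne_top (ReverseHardy.stieltjesConst_ne_top hP))
    refine ⟨K, hK, fun a b _ μ ν u w hu hw hut => ?_⟩
    have hI := ReverseHardy.ordConnected_interval (a := a) (b := b)
    obtain ⟨h1, h2, h3⟩ := ReverseHardy.bestConstant_equiv (p := p) (q := ∞) (μ := μ) (ν := ν)
      (u := u) (w := w) (I := ReverseHardy.interval a b)
      (B := ReverseHardy.B₃ p (ReverseHardy.interval a b) μ ν u w) hK1 hK1 hK
      (fun hB c hc => ReverseHardy.inequality_of_B₃ hp0 hpt.ne hI.measurableSet hu hw hut hB hc)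
      fun c hc => by
        rw [one_mul]
        exact ReverseHardy.B₃_le hp0 hpt.ne hI.measurableSet hc
    refine ⟨h1, h2, h3, ?_, ?_⟩
    · exact (ReverseHardy.B₃Stieltjes_le hp0 hpt.ne hI hu hw hut).trans (mul_le_mul' hK2 le_rfl)
    · exact (ReverseHardy.B₃_le_B₃Stieltjes hp0 hpt.ne hI ReverseHardy.exists_lt_mem_interval
        hu hw).trans (mul_le_mul' hK3 le_rfl)
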